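/- **Theorem (the noncrossing fan).** Fix integers $2\le k<n$, and write $[n]=\{1,\dots,n\}$. *Setting.* Let $\tilde{\mathbb T}^{k,n}=(\mathbb R^{n-k})^k$ with basis $\tilde e_{i,s}$ ($1\le i\le k$, $1\le s\le n-k$) and lattice $(\mathbb Z^{n-k})^k$. Let $\mathbb T^{k,n}=\bigl(\mathbb R^{n-k}/\mathbb R(1,\dots,1)\bigr)^{k-1}$, with lattice $\mathbb T^{k,n}_{\mathbb Z}$ the image of $(\mathbb Z^{n-k})^{k-1}$, and let $e_{i,s}$ ($1\le i\le k-1$) be the images of the standard basis vectors. For $J=\{j_1<\cdots<j_k\}\subseteq[n]$ put $$\tilde{\mathfrak t}_J=\sum_{i=1}^{k}\ \sum_{s=1}^{j_i-i}\tilde e_{i,s}\in\tilde{\mathbb T}^{k,n},\qquad \mathfrak t_J=\sum_{i=1}^{k-1}\ \sum_{s=j_i-(i-1)}^{j_{i+1}-(i+1)}e_{i,s}\in\mathbb T^{k,n}_{\mathbb Z}.$$ Let $\Phi:\tilde{\mathbb T}^{k,n}\to\mathbb T^{k,n}$ be the linear map whose $i$-th component sends $x=(x_1,\dots,x_k)$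 to the class of $x_{i+1}-x_i$, for $1\le i\le k-1$. A $k$-subset is *non-cyclic* if it is not a cyclic interval $\{a,a+1,\dots,a+k-1\}$ modulo $n$. Two subsets $I,J$ of $[n]$ are *weakly separated* if $e_I-e_J\in\mathbb R^n$ has at most two sign changes when read cyclically (ignoring zeros). Two $k$-subsets $I=\{i_1<\cdots<i_k\}$ and $J=\{j_1<\cdots<j_k\}$ are *noncrossing* if for all $1\le a<b\le k$ either $\{i_a,\dots,i_b\}$ and $\{j_a,\dots,j_b\}$ are weakly separated, or $\{i_{a+1},\dots,i_{b-1}\}\ne\{j_{a+1},\dots,j_{b-1}\}$. Let $\widetilde{\mathrm{NC}}_{k,n}$ be the set of all collections of pairwise noncrossing $k$-subsets of $[n]$, and $\mathrm{NC}_{k,n}$ the set of those collections in it all of whose members are non-cyclic. For $\mathcal K\in\mathrm{NC}_{k,n}$ let $C_{\mathcal K}$ be the cone generated by $\{\mathfrak t_J: J\in\mathcal K\}$ (so $C_\emptyset=\{0\}$). The *noncrossing fan* is $F=\{C_{\mathcal K}:\mathcal K\in\mathrm{NC}_{k,n}\}$. *Conclusion.* 1. $F$ is a complete unimodular simplicial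 fan in $\mathbb T^{k,n}$. That is, $F$ is a finite collection of strongly convex polyhedral cones, closed under taking faces, in which any two cones meet in a common face; the cones of $F$ cover $\mathbb T^{k,n}$; and every cone of $F$ is generated by a linearly independent set, and by a subset of a $\mathbb Z$-basis of $\mathbb T^{k,n}_{\mathbb Z}$. Moreover $\mathcal K\mapsto C_{\mathcal K}$ is injective on $\mathrm{NC}_{k,n}$, and for each $\mathcal K\in\mathrm{NC}_{k,n}$ the vectors $\mathfrak t_J$, $J\in\mathcal K$, are linearly independent and form part of a $\mathbb Z$-basis of $\mathbb T^{k,n}_{\mathbb Z}$. 2. The simplices $\sigma_{\mathcal K}=\operatorname{conv}(\tilde{\mathfrak t}_J:J\in\mathcal K)$, for nonempty $\mathcal K\in\widetilde{\mathrm{NC}}_{k,n}$, form a triangulation of the order polytope $O_{k,n}=\operatorname{conv}\bigl(\tilde{\mathfrak t}_J: J\subseteq[n],\ |J|=k\bigr)$. It is regular (induced as the lower hull of some height function on the points $\tilde{\mathfrak t}_J$) and unimodular (the edge vectors of each maximal simplex at any of its vertices form a $\mathbb Z$-basis of $(\mathbb Z^{n-k})^k$). 3. $F$ is obtained by projecting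 this triangulation along $\Phi$. Namely, $\Phi(\tilde{\mathfrak t}_J)=\mathfrak t_J$ for every $k$-subset $J$. Discarding the cyclic intervals, $\mathcal K\mapsto\mathcal K^{\mathrm{ncyc}}$, is a bijection from the maximal elements of $\widetilde{\mathrm{NC}}_{k,n}$ to the maximal elements of $\mathrm{NC}_{k,n}$. For each maximal $\mathcal K\in\widetilde{\mathrm{NC}}_{k,n}$, the image $\Phi(\sigma_{\mathcal K})$ is $\operatorname{conv}\bigl(\{0\}\cup\{\mathfrak t_J: J\in\mathcal K^{\mathrm{ncyc}}\}\bigr)$, and it generates the cone $C_{\mathcal K^{\mathrm{ncyc}}}$. Finally, $F$ is exactly the set of cones generated by the images $\Phi(\sigma_{\mathcal K})$, $\mathcal K\in\widetilde{\mathrm{NC}}_{k,n}$ (with $\sigma_\emptyset=\emptyset$, which generates $\{0\}$). -/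

import Mathlib

noncomputable section

namespace NCFan

/-! ### Generalities on fans and triangulations -/

/-- `S` is a subset of some `ℤ`-basis of the lattice `L`. -/
def IsPartOfLatticeBasis {V : Type*} [AddCommGroup V] (L : AddSubgroup V) (S : Set V) : Prop :=
  ∃ (ι : Type) (b : Module.Basis ι ℤ L), S ⊆ Set.range (fun i => (b i : V))

/-- `S` is a `ℤ`-basis of the lattice `L`. -/
def IsLatticeBasis {V : Type*} [AddCommGroup V] (L : AddSubgroup V) (S : Set V) : Prop :=
  ∃ (ι : Type) (b : Module.Basis ι ℤ L), S = Set.range (fun i => (b i : V))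

/-- A polyhedral fan: a finite nonempty collection of strongly convex polyhedral cones, closed
under taking faces, in which any two cones intersect in a common face. -/
structure IsFan {V : Type*} [AddCommGroup V] [Module ℝ V] (F : Set (PointedCone ℝ V)) : Prop where
  finite : F.Finite
  nonempty : F.Nonempty
  polyhedral : ∀ C ∈ F, ∃ S : Set V, S.Finite ∧ C = PointedCone.hull ℝ S
  stronglyConvex : ∀ C ∈ F, ∀ x ∈ C, -x ∈ C → x = 0
  face_mem : ∀ C ∈ F, ∀ D : PointedCone ℝ V, D.IsFaceOf C → D ∈ F
  inter_isFaceOf : ∀ C ∈ F, ∀ D ∈ F, (C ⊓ D).IsFaceOf C ∧ (C ⊓ D).IsFaceOf D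

/-- The cones of `F` cover the whole space. -/
def IsComplete {V : Type*} [AddCommGroup V] [Module ℝ V] (F : Set (PointedCone ℝ V)) : Prop :=
  ∀ x : V, ∃ C ∈ F, x ∈ C

/-- Every cone of `F` is generated by a subset of a `ℤ`-basis of the lattice `L`. -/
def IsUnimodular {V : Type*} [AddCommGroup V] [Module ℝ V] (L : AddSubgroup V)
    (F : Set (PointedCone ℝ V)) : Prop :=
  ∀ C ∈ F, ∃ S : Set V, IsPartOfLatticeBasis L S ∧ C = PointedCone.hull ℝ S

/-- The simplicial complex `T` is a triangulation of the polytope `P`. -/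
def IsTriangulationOf {V : Type*} [AddCommGroup V] [Module ℝ V]
    (T : Geometry.SimplicialComplex ℝ V) (P : Set V) : Prop :=
  T.faces.Finite ∧ T.space = P

/-- A triangulation is unimodular for `L` when, for each maximal simplex, the edge vectors
emanating from any of its vertices form a `ℤ`-basis of `L`. -/
def IsUnimodularTriangulation {V : Type*} [AddCommGroup V] [Module ℝ V] (L : AddSubgroup V)
    (T : Geometry.SimplicialComplex ℝ V) : Prop :=
  ∀ σ ∈ T.facets, ∀ v ∈ σ, IsLatticeBasis L {x | ∃ w ∈ σ, w ≠ v ∧ x = w - v}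

/-- A triangulation `T` with vertices in the point configuration `A` is regular when there is a
height function `ω` on `A` whose lower faces are exactly the simplices of `T`: a nonempty set of
points is a face of `T` iff it is the set of points of `A` at which some affine function lying
weakly below `ω` on `A` agrees with `ω`. -/
def IsRegularTriangulation {V : Type*} [AddCommGroup V] [Module ℝ V] (A : Set V)
    (T : Geometry.SimplicialComplex ℝ V) : Prop :=
  ∃ ω : V → ℝ, ∀ σ : Finset V, σ.Nonempty →
    (σ ∈ T.faces ↔
      ∃ l : V →ᵃ[ℝ] ℝ, (∀ a ∈ A, l a ≤ ω a) ∧ (σ : Set V) = {a ∈ A | l a = ω a})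

/-! ### Noncrossing subsets -/

/-- The `k`-element subsets of `[n]`. The element `x : Fin n` stands for `x + 1 ∈ {1, …, n}`. -/
abbrev KSubset (k n : ℕ) : Type := {J : Finset (Fin n) // J.card = k}

/-- `J.elt a` is the `a`-th smallest element of `J`, as an element of `Fin n`. -/
def KSubset.elt {k n : ℕ} (J : KSubset k n) : Fin k ↪o Fin n := J.1.orderEmbOfFin J.2

/-- The integer `j_i ∈ {1, …, n}`, where `J = {j_1 < ⋯ < j_k}` and `i = a + 1`. -/
def KSubset.j {k n : ℕ} (J : KSubset k n) (a : Fin k) : ℤ := ((J.elt a : ℕ) : ℤ) + 1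

/-- `J` is a cyclic interval `{a, a + 1, …, a + m - 1}` modulo `n`. -/
def IsCyclicInterval {n : ℕ} (J : Finset (Fin n)) : Prop :=
  ∃ a m : ℕ, ∀ x : Fin n, x ∈ J ↔ ∃ t < m, (x : ℕ) = (a + t) % n

/-- The number of sign changes of a vector read cyclically, zeros being ignored: the number of
ordered pairs of positions carrying opposite signs such that all entries strictly between them,
going cyclically upwards from the first to the second, vanish. -/
def cyclicSignChanges {n : ℕ} (v : Fin n → ℤ) : ℕ :=
  Set.ncard {p : Fin n × Fin n |
    v p.1 * v p.2 < 0 ∧ ∀ r : Fin n, sbtw p.1 r p.2 → v r = 0}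

/-- The indicator vector `e_I`. -/
def indicatorVec {n : ℕ} (I : Finset (Fin n)) : Fin n → ℤ := fun x => if x ∈ I then 1 else 0

/-- `e_I - e_J` has at most two sign changes when read cyclically. -/
def WeaklySeparated {n : ℕ} (I J : Finset (Fin n)) : Prop :=
  cyclicSignChanges (indicatorVec I - indicatorVec J) ≤ 2

/-- The pair `I, J` is noncrossing: for all positions `a < b`, either
`{i_a, …, i_b}` and `{j_a, …, j_b}` are weakly separated, or the interiors
`{i_{a+1}, …, i_{b-1}}` and `{j_{a+1}, …, j_{b-1}}` differ. -/
def Noncrossing {k n : ℕ} (I J : KSubset k n) : Prop :=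
  ∀ a b : Fin k, a < b →
    WeaklySeparated ((Finset.Icc a b).image I.elt) ((Finset.Icc a b).image J.elt) ∨
      (Finset.Ioo a b).image I.elt ≠ (Finset.Ioo a b).image J.elt

/-- All collections of pairwise noncrossing `k`-subsets. -/
def fullNoncrossingComplex (k n : ℕ) : Set (Set (KSubset k n)) :=
  {K | ∀ I ∈ K, ∀ J ∈ K, Noncrossing I J}

/-- The noncrossing complex: all collections of pairwise noncrossing non-cyclic `k`-subsets. -/
def noncrossingComplex (k n : ℕ) : Set (Set (KSubset k n)) :=
  {K | (∀ I ∈ K, ¬ IsCyclicInterval I.1) ∧ ∀ I ∈ K, ∀ J ∈ K, Noncrossing I J}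

/-- The subcollection of the non-cyclic members of a collection. -/
def noncyclicPart {k n : ℕ} (K : Set (KSubset k n)) : Set (KSubset k n) :=
  {J ∈ K | ¬ IsCyclicInterval J.1}

/-! ### The ambient spaces and their lattices -/

/-- `ℝ^N / ℝ(1, …, 1)`. -/
abbrev QuotSpace (N : ℕ) : Type :=
  (Fin N → ℝ) ⧸ Submodule.span ℝ {(fun _ => 1 : Fin N → ℝ)}

/-- The quotient map `ℝ^N → ℝ^N / ℝ(1, …, 1)`. -/
abbrev quotMap (N : ℕ) : (Fin N → ℝ) →ₗ[ℝ] QuotSpace N :=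
  (Submodule.span ℝ {(fun _ => 1 : Fin N → ℝ)}).mkQ

/-- The space `(ℝ^{n-k})^k`. -/
abbrev TTilde (k n : ℕ) : Type := Fin k → Fin (n - k) → ℝ

/-- The space `(ℝ^{n-k} / ℝ(1, …, 1))^{k-1}`. -/
abbrev TSpace (k n : ℕ) : Type := Fin (k - 1) → QuotSpace (n - k)

/-- The integer points of `(ℝ^{n-k})^k`. -/
def latticeTTilde (k n : ℕ) : AddSubgroup (TTilde k n) where
  carrier := {x | ∃ z : Fin k → Fin (n - k) → ℤ, x = fun i s => (z i s : ℝ)}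
  zero_mem' := ⟨0, by ext; simp⟩
  add_mem' := by
    rintro _ _ ⟨z, rfl⟩ ⟨w, rfl⟩
    exact ⟨z + w, by ext; simp⟩
  neg_mem' := by
    rintro _ ⟨z, rfl⟩
    exact ⟨-z, by ext; simp⟩

/-- The integer points of `(ℝ^{n-k} / ℝ(1, …, 1))^{k-1}`: the classes that have an integral
representative in each factor. -/
def latticeT (k n : ℕ) : AddSubgroup (TSpace k n) where
  carrier := {x | ∃ z : Fin (k - 1) → Fin (n - k) → ℤ,
    x = fun i => quotMap (n - k) (fun s => (z i s : ℝ))}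
  zero_mem' := ⟨0, by
    funext i
    rw [show (fun s => (((0 : Fin (k - 1) → Fin (n - k) → ℤ) i s : ℤ) : ℝ)) = 0 by ext; simp,
      map_zero]
    rfl⟩
  add_mem' := by
    rintro _ _ ⟨z, rfl⟩ ⟨w, rfl⟩
    refine ⟨z + w, ?_⟩
    funext i
    rw [show (fun s => (((z + w) i s : ℤ) : ℝ)) =
      (fun s => (z i s : ℝ)) + (fun s => (w i s : ℝ)) by ext; simp, map_add]
    rfl
  neg_mem' := by
    rintro _ ⟨z, rfl⟩
    refine ⟨-z, ?_⟩
    funext i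
    rw [show (fun s => (((-z) i s : ℤ) : ℝ)) = -(fun s => (z i s : ℝ)) by ext; simp, map_neg]
    rfl

/-! ### The noncrossing fan -/

/-- The index `i ∈ {1, …, k - 1}` viewed in `{1, …, k}` (both shifted to start at `0`). -/
def rowLo {k : ℕ} (i : Fin (k - 1)) : Fin k := ⟨i, by omega⟩

/-- The successor `i + 1 ∈ {2, …, k}` of the index `i ∈ {1, …, k - 1}`. -/
def rowHi {k : ℕ} (i : Fin (k - 1)) : Fin k := ⟨i + 1, by omega⟩

/-- The vector `∑_{i=1}^{k-1} ∑_{s = j_i - (i-1)}^{j_{i+1} - (i+1)} e_{i,s}`. The row index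
`r : Fin (k - 1)` stands for `i = r + 1` and `q : Fin (n - k)` stands for `s = q + 1`. -/
def tVec {k n : ℕ} (J : KSubset k n) : TSpace k n := fun r =>
  quotMap (n - k) (fun q =>
    let i : ℤ := ((r : ℕ) : ℤ) + 1
    let s : ℤ := ((q : ℕ) : ℤ) + 1
    if J.j (rowLo r) - (i - 1) ≤ s ∧ s ≤ J.j (rowHi r) - (i + 1) then 1 else 0)

/-- The cone generated by the vectors `tVec J`, for `J` in the collection `K`. -/
def cone {k n : ℕ} (K : Set (KSubset k n)) : PointedCone ℝ (TSpace k n) :=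
  PointedCone.hull ℝ (tVec '' K)

/-- The noncrossing fan. -/
def noncrossingFan (k n : ℕ) : Set (PointedCone ℝ (TSpace k n)) :=
  cone '' noncrossingComplex k n

/-! ### The order polytope and its projection -/

/-- The vector `∑_{i=1}^{k} ∑_{s=1}^{j_i - i} e_{i,s}`, with `i = r + 1` and `s = q + 1`. -/
def tTilde {k n : ℕ} (J : KSubset k n) : TTilde k n := fun r q =>
  let i : ℤ := ((r : ℕ) : ℤ) + 1
  let s : ℤ := ((q : ℕ) : ℤ) + 1
  if s ≤ J.j r - i then 1 else 0

/-- The order polytope: the convex hull of the vectors `tTilde J`. -/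
def orderPolytope (k n : ℕ) : Set (TTilde k n) := convexHull ℝ (Set.range tTilde)

/-- The linear projection sending the basis vector `e_{i,s}` of `(ℝ^{n-k})^k` to `-e_{1,s}` for
`i = 1`, to `-e_{i,s} + e_{i-1,s}` for `2 ≤ i ≤ k - 1`, and to `e_{k-1,s}` for `i = k`; that is,
the `i`-th component of the image of `x` is the class of `x_{i+1} - x_i`. -/
def proj (k n : ℕ) : TTilde k n →ₗ[ℝ] TSpace k n :=
  LinearMap.pi fun r =>
    quotMap (n - k) ∘ₗ
      ((LinearMap.proj (rowHi r) : TTilde k n →ₗ[ℝ] (Fin (n - k) → ℝ)) -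
        LinearMap.proj (rowLo r))

/-- The simplex spanned by the vectors `tTilde J`, for `J` in the collection `K`. -/
def simplex {k n : ℕ} (K : Set (KSubset k n)) : Set (TTilde k n) := convexHull ℝ (tTilde '' K)

end NCFan

end

/-!
The vertices `tTilde J` of the order polytope satisfy two complementary facts, from which everything
else follows formally.

*Exchange.* Two `k`-subsets are noncrossing unless, at some positions `a < b` between which they
agree, their entries interleave: `i_a < j_a < i_b < j_b` or the same with `I` and `J` exchanged
(`noncrossing_iff`). In that case swapping the tails from position `b` on gives two other
`k`-subsets with the same sum of vertices. For the height function
`∑_{c < d} B ^ (k - (d - c)) j_c j_d` with `B` large, the swap lowers the total height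
(`exists_exchange`).

*Uniqueness.* A nonnegative combination of vertices with pairwise noncrossing support is determined
by its total mass and its value (`noncrossing_unique`). These data amount to the distribution of
the entries at each position, and the weights of the initial segments are reconstructed from it one
position at a time (`initial_step`): as for a stack, a new entry has to be attached to the
initial segment that was opened last.

Minimizing the height over all decompositions of a point, with real or with natural number
coefficients, gives existence of noncrossing decompositions, hence together with uniqueness a
triangulation. If `K` is a maximal noncrossing collection, a large multiple of the sum of its
vertices can be perturbed by any vertex without leaving the cone over `K`, with natural number
coefficients (`ExchangeSystem.exists_sum_add_eq`). So `K` generates the lattice, which is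
unimodularity, and the affine function interpolating the heights on `K` lies strictly below all other
heights, which is regularity (`ExchangeSystem.exists_supporting`).

Cyclic intervals are noncrossing with every subset, and the vectors `(1, tTilde J)` with `J` a cyclic
interval span all pairs `(t, x)` with `x` in the kernel of the projection
(`mem_span_lifted_of_proj_eq_zero`). Therefore uniqueness
descends to the quotient (`uniqueDecomposition_tVec`), and it makes the cones a simplicial fan
(`UniqueDecomposition.isFan`). The fan is complete since every integer point becomes a sum of
vertices after adding an element of the kernel (`exists_add_mem_closure`).
-/

namespace NCFan

open Finset Filter Topology

variable {k n : ℕ}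

/-! ### Subsets as strictly increasing sequences -/

/-- The `k`-subset whose elements, in increasing order, are the values of `f`. -/
def KSubset.ofFun (f : Fin k → Fin n) (hf : ∀ ⦃r s⦄, r < s → f r < f s) : KSubset k n :=
  ⟨univ.image f, by
    rw [card_image_of_injective _ (StrictMono.injective hf), card_univ, Fintype.card_fin]⟩

@[simp] lemma KSubset.elt_ofFun (f : Fin k → Fin n) (hf : ∀ ⦃r s⦄, r < s → f r < f s) (r : Fin k) :
    (KSubset.ofFun f hf).elt r = f r :=
  (congrFun (orderEmbOfFin_unique (KSubset.ofFun f hf).2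
    (fun x => mem_image_of_mem f (mem_univ x)) hf) r).symm

lemma KSubset.elt_strictMono (J : KSubset k n) : StrictMono J.elt := J.elt.strictMono

lemma KSubset.ext_elt {I J : KSubset k n} (h : ∀ r, I.elt r = J.elt r) : I = J := by
  have key : ∀ L : KSubset k n, L.1 = univ.image L.elt := by
    intro L
    have := range_orderEmbOfFin L.1 L.2
    apply Finset.coe_injective
    rw [coe_image, coe_univ, Set.image_univ]
    exact this.symm
  apply Subtype.ext
  rw [key I, key J]
  exact image_congr fun r _ => h r

/-- The entries of `J` grow by at least one at each step. -/
lemma KSubset.elt_add_le (J : KSubset k n) {r s : Fin k} (h : r ≤ s) :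
    (J.elt r : ℕ) + s ≤ J.elt s + r := by
  obtain ⟨s, hs⟩ := s
  induction s with
  | zero =>
    have : r = ⟨0, hs⟩ := Fin.ext (by have := Fin.le_def.1 h; simp at this; simpa using this)
    subst this; simp
  | succ s ih =>
    rcases eq_or_lt_of_le h with h | h
    · subst h; simp
    · have hs' : s < k := by omega
      have h1 := ih hs' (by rw [Fin.le_def]; rw [Fin.lt_def] at h; simp at h ⊢; omega)
      have h2 := Fin.lt_def.1 (J.elt_strictMono (show (⟨s, hs'⟩ : Fin k) < ⟨s + 1, hs⟩ by
        rw [Fin.lt_def]; simp))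
      rw [Fin.lt_def] at h
      simp only [] at h1 h ⊢
      omega

lemma KSubset.le_elt (J : KSubset k n) (r : Fin k) : (r : ℕ) ≤ J.elt r := by
  have := J.elt_add_le (r := ⟨0, r.pos⟩) (s := r) (by rw [Fin.le_def]; simp)
  simp at this; omega

lemma KSubset.elt_lt (J : KSubset k n) (r : Fin k) : (J.elt r : ℕ) < n - k + r + 1 := by
  have h := r.2
  have := J.elt_add_le (r := r) (s := ⟨k - 1, by omega⟩) (by rw [Fin.le_def]; simp; omega)
  have h2 := (J.elt ⟨k - 1, by omega⟩).2
  have h3 : k ≤ n := by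
    have := Finset.card_le_univ J.1
    rw [J.2] at this; simpa using this
  simp at this; omega

lemma tTilde_apply (J : KSubset k n) (r : Fin k) (q : Fin (n - k)) :
    tTilde J r q = if (q : ℕ) + r < J.elt r then 1 else 0 := by
  unfold tTilde KSubset.j
  simp only
  congr 1
  apply propext
  constructor <;> intro h <;> omega

lemma tTilde_injective : Function.Injective (tTilde : KSubset k n → TTilde k n) := by
  intro I J h
  apply KSubset.ext_elt
  by_contra! hne
  obtain ⟨r, hr⟩ := hne
  wlog hlt : I.elt r < J.elt r generalizing I J
  · exact this h.symm hr.symm (lt_of_le_of_ne (not_lt.1 hlt) hr.symm)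
  rw [Fin.lt_def] at hlt
  have h1 := I.le_elt r
  have h2 := J.elt_lt r
  have := congrFun (congrFun h r) ⟨(I.elt r : ℕ) - r, by omega⟩
  rw [tTilde_apply, tTilde_apply, if_neg (by simp; omega), if_pos (by simp; omega)] at this
  exact zero_ne_one this

/-! ### Crossing pairs -/

/-- `I` and `J` cross, with `I` starting first: between two positions `a < b` the two sequences
agree, and `i_a < j_a < i_b < j_b`. -/
def Crosses (I J : KSubset k n) : Prop :=
  ∃ a b : Fin k, a < b ∧ (∀ c, a < c → c < b → I.elt c = J.elt c) ∧
    I.elt a < J.elt a ∧ J.elt a < I.elt b ∧ I.elt b < J.elt b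

/-- Four increasing positions carrying alternating signs give at least three sign changes. -/
lemma two_lt_cyclicSignChanges {v : Fin n → ℤ} {p q r s : Fin n} (hpq : p < q) (hqr : q < r)
    (hrs : r < s) (hp : v p * v q < 0) (hq : v q * v r < 0) (hr : v r * v s < 0)
    (h0 : ∀ x, x ≠ p → x ≠ q → x ≠ r → x ≠ s → v x = 0) : 2 < cyclicSignChanges v := by
  have hsb : ∀ x y z : Fin n, sbtw x y z ↔ (x < y ∧ y < z) ∨ (y < z ∧ z < x) ∨ (z < x ∧ x < y) :=
    fun x y z => Iff.rfl
  unfold cyclicSignChanges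
  have hsub : (({(p, q), (q, r), (r, s)} : Finset (Fin n × Fin n)) : Set (Fin n × Fin n)) ⊆
      {p : Fin n × Fin n | v p.1 * v p.2 < 0 ∧ ∀ r : Fin n, sbtw p.1 r p.2 → v r = 0} := by
    intro x hx
    simp only [coe_insert, coe_singleton, Set.mem_insert_iff, Set.mem_singleton_iff] at hx
    rcases hx with rfl | rfl | rfl
    · refine ⟨hp, fun x hx => h0 x ?_ ?_ ?_ ?_⟩ <;> rintro rfl <;> rw [hsb] at hx <;>
        simp only [Fin.lt_def] at * <;> omega
    · refine ⟨hq, fun x hx => h0 x ?_ ?_ ?_ ?_⟩ <;> rintro rfl <;> rw [hsb] at hx <;>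
        simp only [Fin.lt_def] at * <;> omega
    · refine ⟨hr, fun x hx => h0 x ?_ ?_ ?_ ?_⟩ <;> rintro rfl <;> rw [hsb] at hx <;>
        simp only [Fin.lt_def] at * <;> omega
  have hcard : ({(p, q), (q, r), (r, s)} : Finset (Fin n × Fin n)).card = 3 := by
    rw [card_eq_three]
    refine ⟨_, _, _, ?_, ?_, ?_, rfl⟩ <;> simp only [ne_eq, Prod.mk.injEq, not_and] <;>
      intro h <;> subst h <;> simp only [Fin.lt_def] at * <;> omega
  have := Set.ncard_le_ncard hsub (Set.toFinite _)
  rw [Set.ncard_coe_finset, hcard] at this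
  omega

lemma cyclicSignChanges_le_two {v : Fin n → ℤ} (x y : Fin n × Fin n)
    (h : ∀ p q, v p * v q < 0 → (∀ r, sbtw p r q → v r = 0) → (p, q) = x ∨ (p, q) = y) :
    cyclicSignChanges v ≤ 2 := by
  have hsub : {p : Fin n × Fin n | v p.1 * v p.2 < 0 ∧ ∀ r : Fin n, sbtw p.1 r p.2 → v r = 0} ⊆
      ({x, y} : Set (Fin n × Fin n)) := fun p hp => h p.1 p.2 hp.1 hp.2
  exact (Set.ncard_le_ncard hsub (Set.toFinite _)).trans
    ((Set.ncard_insert_le _ _).trans (by rw [Set.ncard_singleton]))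

/-- Two nonzero entries produce at most two sign changes. -/
lemma cyclicSignChanges_le_two_of_pair {v : Fin n → ℤ} (p q : Fin n)
    (h0 : ∀ x, x ≠ p → x ≠ q → v x = 0) : cyclicSignChanges v ≤ 2 := by
  refine cyclicSignChanges_le_two (p, q) (q, p) fun a b hab _ => ?_
  have ha : a = p ∨ a = q := by
    by_contra! h; rw [h0 a h.1 h.2] at hab; simp at hab
  have hb : b = p ∨ b = q := by
    by_contra! h; rw [h0 b h.1 h.2] at hab; simp at hab
  rcases ha with rfl | rfl <;> rcases hb with rfl | rfl
  · exact absurd hab (not_lt.2 (mul_self_nonneg _))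
  · simp
  · simp
  · exact absurd hab (not_lt.2 (mul_self_nonneg _))

lemma cyclicSignChanges_neg (v : Fin n → ℤ) : cyclicSignChanges (-v) = cyclicSignChanges v := by
  simp [cyclicSignChanges]

/-- The sign pattern `+ - - +` has two cyclic sign changes. -/
lemma cyclicSignChanges_le_two_of_nested {v : Fin n → ℤ} {p q r s : Fin n} (hpq : p < q)
    (hqr : q < r) (hrs : r < s) (hp : 0 < v p) (hq : v q < 0) (hr : v r < 0) (hs : 0 < v s)
    (h0 : ∀ x, x ≠ p → x ≠ q → x ≠ r → x ≠ s → v x = 0) : cyclicSignChanges v ≤ 2 := by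
  have hsb : ∀ x y z : Fin n, sbtw x y z ↔ (x < y ∧ y < z) ∨ (y < z ∧ z < x) ∨ (z < x ∧ x < y) :=
    fun x y z => Iff.rfl
  have mem : ∀ x, v x ≠ 0 → x = p ∨ x = q ∨ x = r ∨ x = s := by
    intro x hx; by_contra! h; exact hx (h0 x h.1 h.2.1 h.2.2.1 h.2.2.2)
  refine cyclicSignChanges_le_two (p, q) (r, s) fun a b hab hbt => ?_
  have ha := mem a (by rintro h; simp [h] at hab)
  have hb := mem b (by rintro h; simp [h] at hab)
  have kp : ¬ sbtw a p b := fun h => by have := hbt _ h; omega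
  have kq : ¬ sbtw a q b := fun h => by have := hbt _ h; omega
  have kr : ¬ sbtw a r b := fun h => by have := hbt _ h; omega
  have ks : ¬ sbtw a s b := fun h => by have := hbt _ h; omega
  rw [hsb] at kp kq kr ks
  rcases ha with rfl | rfl | rfl | rfl <;> rcases hb with rfl | rfl | rfl | rfl <;>
    first
    | (left; rfl)
    | (right; rfl)
    | (exfalso; nlinarith)
    | (exfalso; simp only [Fin.lt_def] at *; omega)

/-- The sign pattern `+ + - -` has two cyclic sign changes. -/
lemma cyclicSignChanges_le_two_of_disjoint {v : Fin n → ℤ} {p q r s : Fin n} (hpq : p < q)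
    (hqr : q < r) (hrs : r < s) (hp : 0 < v p) (hq : 0 < v q) (hr : v r < 0) (hs : v s < 0)
    (h0 : ∀ x, x ≠ p → x ≠ q → x ≠ r → x ≠ s → v x = 0) : cyclicSignChanges v ≤ 2 := by
  have hsb : ∀ x y z : Fin n, sbtw x y z ↔ (x < y ∧ y < z) ∨ (y < z ∧ z < x) ∨ (z < x ∧ x < y) :=
    fun x y z => Iff.rfl
  have mem : ∀ x, v x ≠ 0 → x = p ∨ x = q ∨ x = r ∨ x = s := by
    intro x hx; by_contra! h; exact hx (h0 x h.1 h.2.1 h.2.2.1 h.2.2.2)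
  refine cyclicSignChanges_le_two (q, r) (s, p) fun a b hab hbt => ?_
  have ha := mem a (by rintro h; simp [h] at hab)
  have hb := mem b (by rintro h; simp [h] at hab)
  have kp : ¬ sbtw a p b := fun h => by have := hbt _ h; omega
  have kq : ¬ sbtw a q b := fun h => by have := hbt _ h; omega
  have kr : ¬ sbtw a r b := fun h => by have := hbt _ h; omega
  have ks : ¬ sbtw a s b := fun h => by have := hbt _ h; omega
  rw [hsb] at kp kq kr ks
  rcases ha with rfl | rfl | rfl | rfl <;> rcases hb with rfl | rfl | rfl | rfl <;>
    first
    | (left; rfl)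
    | (right; rfl)
    | (exfalso; nlinarith)
    | (exfalso; simp only [Fin.lt_def] at *; omega)

/-- Increasing sequences with the same set of values on an interval of positions agree there. -/
lemma image_Ioo_eq_iff (I J : KSubset k n) (a b : Fin k) :
    (Ioo a b).image I.elt = (Ioo a b).image J.elt ↔ ∀ c, a < c → c < b → I.elt c = J.elt c := by
  constructor
  · intro h c
    induction c using WellFoundedLT.induction with
    | _ c ih =>
    intro hac hcb
    by_contra hne
    -- the smaller of the two `c`-th entries occurs earlier in the other sequence
    have key : ∀ I J : KSubset k n, (Ioo a b).image I.elt = (Ioo a b).image J.elt →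
        (∀ d < c, a < d → d < b → I.elt d = J.elt d) → ¬ I.elt c < J.elt c := by
      intro I J h ih hlt
      obtain ⟨d, hd, hdc⟩ := mem_image.1 (h ▸ mem_image_of_mem I.elt (mem_Ioo.2 ⟨hac, hcb⟩))
      rw [mem_Ioo] at hd
      have hdlt : d < c := J.elt_strictMono.lt_iff_lt.1 (hdc ▸ hlt)
      rw [← ih d hdlt hd.1 hd.2] at hdc
      exact hdlt.ne (I.elt.injective hdc)
    rcases lt_or_gt_of_ne hne with h1 | h1
    · exact key I J h ih h1
    · exact key J I h.symm (fun d h1 h2 h3 => (ih d h1 h2 h3).symm) h1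
  · intro h
    exact image_congr fun c hc => h c (mem_Ioo.1 hc).1 (mem_Ioo.1 hc).2

lemma indicator_image_Icc (I : KSubset k n) {a b : Fin k} (hab : a < b) (x : Fin n) :
    indicatorVec ((Icc a b).image I.elt) x =
      if x = I.elt a ∨ x = I.elt b ∨ x ∈ (Ioo a b).image I.elt then 1 else 0 := by
  unfold indicatorVec
  congr 1
  apply propext
  rw [← Ioc_insert_left hab.le, ← Ioo_insert_right hab, image_insert, image_insert,
    mem_insert, mem_insert]

lemma WeaklySeparated.symm {I J : Finset (Fin n)} (h : WeaklySeparated I J) :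
    WeaklySeparated J I := by
  unfold WeaklySeparated at *
  rwa [← cyclicSignChanges_neg, neg_sub]

lemma elt_notMem_image_Ioo_left (I J : KSubset k n) {a b : Fin k} (hJ : I.elt a ≤ J.elt a) :
    I.elt a ∉ (Ioo a b).image J.elt := by
  intro h
  obtain ⟨c, hc, h⟩ := mem_image.1 h
  exact (hJ.trans_lt (J.elt_strictMono (mem_Ioo.1 hc).1)).ne' h

lemma elt_notMem_image_Ioo_right (I J : KSubset k n) {a b : Fin k} (hJ : J.elt b ≤ I.elt b) :
    I.elt b ∉ (Ioo a b).image J.elt := by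
  intro h
  obtain ⟨c, hc, h⟩ := mem_image.1 h
  exact ((J.elt_strictMono (mem_Ioo.1 hc).2).trans_le hJ).ne h

lemma Crosses.not_weaklySeparated {I J : KSubset k n} {a b : Fin k} (hab : a < b)
    (hM : (Ioo a b).image I.elt = (Ioo a b).image J.elt) (h1 : I.elt a < J.elt a)
    (h2 : J.elt a < I.elt b) (h3 : I.elt b < J.elt b) :
    ¬ WeaklySeparated ((Icc a b).image I.elt) ((Icc a b).image J.elt) := by
  unfold WeaklySeparated
  rw [not_le]
  have e1 := elt_notMem_image_Ioo_left I I (b := b) (le_refl (I.elt a))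
  have e2 := elt_notMem_image_Ioo_right I I (a := a) (le_refl (I.elt b))
  have e3 := elt_notMem_image_Ioo_left J J (b := b) (le_refl (J.elt a))
  have e4 := elt_notMem_image_Ioo_right J J (a := a) (le_refl (J.elt b))
  rw [← hM] at e3 e4
  have v1 : (indicatorVec ((Icc a b).image I.elt) - indicatorVec ((Icc a b).image J.elt))
      (I.elt a) = 1 := by
    rw [Pi.sub_apply, indicator_image_Icc I hab, indicator_image_Icc J hab, ← hM,
      if_pos (Or.inl rfl), if_neg, sub_zero]
    simp only [e1, or_false, not_or]
    exact ⟨h1.ne, (h1.trans (h2.trans h3)).ne⟩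
  have v2 : (indicatorVec ((Icc a b).image I.elt) - indicatorVec ((Icc a b).image J.elt))
      (J.elt a) = -1 := by
    rw [Pi.sub_apply, indicator_image_Icc I hab, indicator_image_Icc J hab, ← hM,
      if_pos (Or.inl rfl), if_neg, zero_sub]
    simp only [e3, or_false, not_or]
    exact ⟨h1.ne', h2.ne⟩
  have v3 : (indicatorVec ((Icc a b).image I.elt) - indicatorVec ((Icc a b).image J.elt))
      (I.elt b) = 1 := by
    rw [Pi.sub_apply, indicator_image_Icc I hab, indicator_image_Icc J hab, ← hM,
      if_pos (Or.inr (Or.inl rfl)), if_neg, sub_zero]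
    simp only [e2, or_false, not_or]
    exact ⟨h2.ne', h3.ne⟩
  have v4 : (indicatorVec ((Icc a b).image I.elt) - indicatorVec ((Icc a b).image J.elt))
      (J.elt b) = -1 := by
    rw [Pi.sub_apply, indicator_image_Icc I hab, indicator_image_Icc J hab, ← hM,
      if_pos (Or.inr (Or.inl rfl)), if_neg, zero_sub]
    simp only [e4, or_false, not_or]
    exact ⟨(h1.trans (h2.trans h3)).ne', h3.ne'⟩
  refine two_lt_cyclicSignChanges h1 h2 h3 (by rw [v1, v2]; norm_num) (by rw [v2, v3]; norm_num)
    (by rw [v3, v4]; norm_num) fun x x1 x2 x3 x4 => ?_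
  rw [Pi.sub_apply, indicator_image_Icc I hab, indicator_image_Icc J hab, ← hM]
  simp [x1, x2, x3, x4]

lemma weaklySeparated_of_not_crosses {I J : KSubset k n} {a b : Fin k} (hab : a < b)
    (hM : (Ioo a b).image I.elt = (Ioo a b).image J.elt)
    (h1 : ¬ (I.elt a < J.elt a ∧ J.elt a < I.elt b ∧ I.elt b < J.elt b))
    (h2 : ¬ (J.elt a < I.elt a ∧ I.elt a < J.elt b ∧ J.elt b < I.elt b)) :
    WeaklySeparated ((Icc a b).image I.elt) ((Icc a b).image J.elt) := by
  wlog hle : I.elt a ≤ J.elt a generalizing I J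
  · exact (this hM.symm h2 h1 (not_le.1 hle).le).symm
  unfold WeaklySeparated
  set v := indicatorVec ((Icc a b).image I.elt) - indicatorVec ((Icc a b).image J.elt) with hv
  have e1 := elt_notMem_image_Ioo_left I I (b := b) (le_refl (I.elt a))
  have e2 := elt_notMem_image_Ioo_right I I (a := a) (le_refl (I.elt b))
  have e3 := elt_notMem_image_Ioo_left J J (b := b) (le_refl (J.elt a))
  have e4 := elt_notMem_image_Ioo_right J J (a := a) (le_refl (J.elt b))
  rw [← hM] at e3 e4
  have hI := I.elt_strictMono hab
  have hJ := J.elt_strictMono hab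
  have hvx : ∀ x, v x = (if x = I.elt a ∨ x = I.elt b ∨ x ∈ (Ioo a b).image I.elt then 1 else 0) -
      if x = J.elt a ∨ x = J.elt b ∨ x ∈ (Ioo a b).image I.elt then 1 else 0 := by
    intro x
    rw [hv, Pi.sub_apply, indicator_image_Icc I hab, indicator_image_Icc J hab, ← hM]
  clear_value v
  have h0 : ∀ x, x ≠ I.elt a → x ≠ I.elt b → x ≠ J.elt a → x ≠ J.elt b → v x = 0 := by
    intro x x1 x2 x3 x4
    rw [hvx]; simp [x1, x2, x3, x4]
  rcases hle.eq_or_lt with haa | haa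
  · refine cyclicSignChanges_le_two_of_pair (I.elt b) (J.elt b) fun x x2 x4 => ?_
    rw [hvx]; simp [haa, x2, x4]
  rcases eq_or_ne (I.elt b) (J.elt b) with hbb | hbb
  · refine cyclicSignChanges_le_two_of_pair (I.elt a) (J.elt a) fun x x1 x3 => ?_
    rw [hvx]; simp [hbb, x1, x3]
  rcases eq_or_ne (I.elt b) (J.elt a) with hba | hba
  · refine cyclicSignChanges_le_two_of_pair (I.elt a) (J.elt b) fun x x1 x4 => ?_
    rw [hvx]; simp [hba, x1, x4]
  have v1 : 0 < v (I.elt a) := by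
    by_cases hx : I.elt a = J.elt b
    · exact absurd (hx ▸ haa) hJ.not_gt
    · rw [hvx, if_pos (Or.inl rfl), if_neg (by simp only [e1, hx, haa.ne, or_self, not_false_eq_true])]
      norm_num
  have v2 : 0 < v (I.elt b) := by
    rw [hvx, if_pos (Or.inr (Or.inl rfl)),
      if_neg (by simp only [e2, hba, hbb, or_self, not_false_eq_true])]
    norm_num
  have v3 : v (J.elt a) < 0 := by
    rw [hvx, if_neg (by simp only [e3, hba.symm, haa.ne', or_self, not_false_eq_true]),
      if_pos (Or.inl rfl)]
    norm_num
  have v4 : v (J.elt b) < 0 := by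
    rw [hvx, if_neg (by simp only [e4, hbb.symm, (haa.trans hJ).ne', or_self, not_false_eq_true]),
      if_pos (Or.inr (Or.inl rfl))]
    norm_num
  rcases lt_or_gt_of_ne hbb with hlt | hlt
  · have hba' : I.elt b < J.elt a := lt_of_le_of_ne (not_lt.1 fun h => h1 ⟨haa, h, hlt⟩) hba
    exact cyclicSignChanges_le_two_of_disjoint hI hba' hJ v1 v2 v3 v4 h0
  · exact cyclicSignChanges_le_two_of_nested haa hJ hlt v1 v3 v4 v2
      fun x x1 x2 x3 x4 => h0 x x1 x4 x2 x3

/-- Two `k`-subsets are noncrossing iff neither crosses the other. -/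
lemma noncrossing_iff (I J : KSubset k n) :
    Noncrossing I J ↔ ¬ Crosses I J ∧ ¬ Crosses J I := by
  constructor
  · intro h
    constructor
    · rintro ⟨a, b, hab, hM, h1, h2, h3⟩
      rw [← image_Ioo_eq_iff] at hM
      rcases h a b hab with hw | hw
      · exact Crosses.not_weaklySeparated hab hM h1 h2 h3 hw
      · exact hw hM
    · rintro ⟨a, b, hab, hM, h1, h2, h3⟩
      rw [← image_Ioo_eq_iff] at hM
      rcases h a b hab with hw | hw
      · exact Crosses.not_weaklySeparated hab hM h1 h2 h3 hw.symm
      · exact hw hM.symm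
  · rintro ⟨h1, h2⟩ a b hab
    by_cases hM : (Ioo a b).image I.elt = (Ioo a b).image J.elt
    · refine Or.inl (weaklySeparated_of_not_crosses hab hM (fun h => h1 ?_) (fun h => h2 ?_))
      · exact ⟨a, b, hab, (image_Ioo_eq_iff I J a b).1 hM, h⟩
      · exact ⟨a, b, hab, (image_Ioo_eq_iff J I a b).1 hM.symm, h⟩
    · exact Or.inr hM

lemma Noncrossing.symm {I J : KSubset k n} (h : Noncrossing I J) : Noncrossing J I := by
  rw [noncrossing_iff] at *
  exact ⟨h.2, h.1⟩

lemma noncrossing_self (I : KSubset k n) : Noncrossing I I := by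
  rw [noncrossing_iff, and_self]
  rintro ⟨a, b, -, -, h, -⟩
  exact lt_irrefl _ h

/-! ### Exchanging the tails of a crossing pair -/

/-- The subset with the entries of `I` before position `b` and those of `J` from `b` on. -/
def KSubset.splice (I J : KSubset k n) (b : Fin k)
    (h : ∀ c < b, I.elt c < J.elt b) : KSubset k n :=
  KSubset.ofFun (fun c => if c < b then I.elt c else J.elt c) (by
    intro c d hcd
    split_ifs with hc hd hd
    · exact I.elt_strictMono hcd
    · exact (h c hc).trans_le (J.elt_strictMono.monotone (not_lt.1 hd))
    · exact absurd (hcd.trans hd) hc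
    · exact J.elt_strictMono hcd)

lemma KSubset.elt_splice (I J : KSubset k n) (b : Fin k) (h : ∀ c < b, I.elt c < J.elt b)
    (c : Fin k) : (I.splice J b h).elt c = if c < b then I.elt c else J.elt c :=
  KSubset.elt_ofFun _ _ c

/-- The weight of a pair of positions in the height function: positions at smaller distance
count for much more. -/
def pairWeight (k n : ℕ) (c d : Fin k) : ℝ :=
  if c < d then ((k * k * (n * n) + 1 : ℕ) : ℝ) ^ (k - (d - c : ℕ)) else 0

/-- The height of a `k`-subset: the sum of the products of pairs of its entries, weighted
according to the distance of their positions. -/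
def height (J : KSubset k n) : ℝ :=
  ∑ p : Fin k × Fin k, pairWeight k n p.1 p.2 * ((J.elt p.1 : ℕ) : ℝ) * ((J.elt p.2 : ℕ) : ℝ)

/-- A crossing pair can be replaced by a pair of smaller total height with the same multiset of
entries at each position. At the innermost pair of positions where the two sequences differ the
height drops by the product of the two differences, and all other pairs of positions that are
affected have a larger distance, hence negligible weight. -/
lemma Crosses.exists_exchange {I J : KSubset k n} (h : Crosses I J) :
    ∃ I' J' : KSubset k n,
      (∀ c, (I'.elt c = I.elt c ∧ J'.elt c = J.elt c) ∨ (I'.elt c = J.elt c ∧ J'.elt c = I.elt c)) ∧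
      height I' + height J' < height I + height J := by
  obtain ⟨a, b, hab, hM, h1, h2, h3⟩ := h
  have hIJ : ∀ c < b, I.elt c < J.elt b := fun c hc => (I.elt_strictMono hc).trans h3
  have hJI : ∀ c < b, J.elt c < I.elt b := by
    intro c hc
    rcases lt_or_ge a c with hac | hac
    · rw [← hM c hac hc]; exact I.elt_strictMono hc
    · exact (J.elt_strictMono.monotone hac).trans_lt h2
  refine ⟨I.splice J b hIJ, J.splice I b hJI, fun c => ?_, ?_⟩
  · rw [KSubset.elt_splice, KSubset.elt_splice]
    split_ifs <;> simp
  set B : ℝ := ((k * k * (n * n) + 1 : ℕ) : ℝ) with hB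
  have hB1 : 1 ≤ B := by rw [hB]; push_cast; nlinarith [(k * k * (n * n) : ℕ).cast_nonneg (α := ℝ)]
  set e := k - (b - a : ℕ) - 1 with he
  set D : Fin k → ℝ := fun c => ((I.elt c : ℕ) : ℝ) - ((J.elt c : ℕ) : ℝ) with hD
  have hDn : ∀ c, |D c| ≤ n := by
    intro c
    have i1 : ((I.elt c : ℕ) : ℝ) ≤ n := by exact_mod_cast (I.elt c).2.le
    have i2 : ((J.elt c : ℕ) : ℝ) ≤ n := by exact_mod_cast (J.elt c).2.le
    have i3 : (0 : ℝ) ≤ ((I.elt c : ℕ) : ℝ) := Nat.cast_nonneg _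
    have i4 : (0 : ℝ) ≤ ((J.elt c : ℕ) : ℝ) := Nat.cast_nonneg _
    rw [abs_le]; constructor <;> simp only [hD] <;> linarith
  have hD0 : ∀ c, a < c → c < b → D c = 0 := by
    intro c h h'; simp [hD, hM c h h']
  -- the change of height, as a sum over pairs of positions on both sides of the cut
  have hdiff : height I + height J - (height (I.splice J b hIJ) + height (J.splice I b hJI)) =
      ∑ p : Fin k × Fin k, if p.1 < b ∧ b ≤ p.2 then pairWeight k n p.1 p.2 * (D p.1 * D p.2)
        else 0 := by
    unfold height
    rw [← sum_add_distrib, ← sum_add_distrib, ← sum_sub_distrib]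
    refine sum_congr rfl fun p _ => ?_
    simp only [KSubset.elt_splice, hD]
    have hle : b ≤ p.2 ↔ ¬ p.2 < b := not_lt.symm
    by_cases hc : p.1 < b <;> by_cases hd : p.2 < b
    · simp only [hle, hc, hd, if_true, not_true, and_false, if_false]; ring
    · simp only [hle, hc, hd, if_true, if_false, not_false_eq_true, and_self]; ring
    · have : pairWeight k n p.1 p.2 = 0 := if_neg fun h => hc (h.trans hd)
      simp only [this]; simp
    · simp only [hle, hc, hd, if_false, false_and]; ring
  have hBe : 0 < B ^ e := by positivity
  have hlower : ∀ p ∈ (univ : Finset (Fin k × Fin k)),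
      (if p = (a, b) then B ^ (e + 1) else 0) - B ^ e * (n * n) ≤
      if p.1 < b ∧ b ≤ p.2 then pairWeight k n p.1 p.2 * (D p.1 * D p.2) else 0 := by
    rintro ⟨c, d⟩ -
    dsimp only
    have hpos : 0 ≤ B ^ e * ((n : ℝ) * n) := by positivity
    by_cases hp : (c, d) = (a, b)
    · rw [if_pos hp]
      obtain ⟨rfl, rfl⟩ := Prod.mk.inj hp
      rw [if_pos ⟨hab, le_rfl⟩]
      have hw : pairWeight k n c d = B ^ (e + 1) := by
        unfold pairWeight
        rw [if_pos hab, hB]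
        congr 1
        have := d.2
        rw [Fin.lt_def] at hab
        omega
      have hDc : 1 ≤ -D c := by
        have : ((I.elt c : ℕ) : ℝ) + 1 ≤ ((J.elt c : ℕ) : ℝ) := by exact_mod_cast h1
        simp only [hD]; linarith
      have hDd : 1 ≤ -D d := by
        have : ((I.elt d : ℕ) : ℝ) + 1 ≤ ((J.elt d : ℕ) : ℝ) := by exact_mod_cast h3
        simp only [hD]; linarith
      rw [hw]
      have : 1 ≤ D c * D d := by nlinarith
      have h4 : 0 < B ^ (e + 1) := by positivity
      nlinarith
    · rw [if_neg hp]
      split_ifs with hcd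
      · have habs : |pairWeight k n c d * (D c * D d)| ≤ B ^ e * (n * n) := by
          by_cases hz : D c * D d = 0
          · rw [hz, mul_zero, abs_zero]; exact hpos
          have hca : c ≤ a := by
            by_contra h
            exact hz (by rw [hD0 c (not_le.1 h) hcd.1, zero_mul])
          have hw : |pairWeight k n c d| ≤ B ^ e := by
            unfold pairWeight
            rw [if_pos (hcd.1.trans_le hcd.2), ← hB, abs_of_nonneg (by positivity)]
            refine pow_le_pow_right₀ hB1 ?_
            have hne : ¬ (c = a ∧ d = b) := fun h => hp (by rw [h.1, h.2])
            rw [Fin.ext_iff, Fin.ext_iff] at hne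
            have h5 := hcd.2
            rw [Fin.le_def] at hca h5
            omega
          rw [abs_mul, abs_mul]
          exact mul_le_mul hw (mul_le_mul (hDn c) (hDn d) (abs_nonneg _) (by positivity))
            (by positivity) hBe.le
        have := (abs_le.1 habs).1
        linarith
      · linarith
  have hsum := sum_le_sum hlower
  rw [← hdiff, sum_sub_distrib, sum_ite_eq' univ (a, b), if_pos (mem_univ _), sum_const, card_univ,
    Fintype.card_prod, Fintype.card_fin, nsmul_eq_mul] at hsum
  have : 0 < B ^ (e + 1) - ((k * k : ℕ) : ℝ) * (B ^ e * (n * n)) := by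
    have : B ^ (e + 1) - ((k * k : ℕ) : ℝ) * (B ^ e * (n * n)) = B ^ e := by
      rw [pow_succ]; nth_rewrite 2 [hB]; push_cast; ring
    rw [this]; exact hBe
  linarith

lemma exists_exchange {I J : KSubset k n} (h : ¬ Noncrossing I J) :
    ∃ I' J' : KSubset k n, tTilde I + tTilde J = tTilde I' + tTilde J' ∧
      height I' + height J' < height I + height J := by
  wlog hc : Crosses I J generalizing I J
  · have hJI : Crosses J I := by
      rw [noncrossing_iff] at h; tauto
    obtain ⟨I', J', e1, e2⟩ := this (fun h' => h h'.symm) hJI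
    exact ⟨I', J', by rw [add_comm, e1], by linarith⟩
  obtain ⟨I', J', e1, e2⟩ := hc.exists_exchange
  refine ⟨I', J', ?_, e2⟩
  funext r q
  rw [Pi.add_apply, Pi.add_apply, Pi.add_apply, Pi.add_apply]
  simp only [tTilde_apply]
  rcases e1 r with ⟨h1, h2⟩ | ⟨h1, h2⟩ <;> rw [h1, h2]
  rw [add_comm]

/-! ### Uniqueness of noncrossing decompositions -/

/-- The first `b` entries of `J`, padded with zeros. The entries are shifted by one so that they
differ from the padding. -/
def KSubset.initial (J : KSubset k n) (b : ℕ) : Fin k → ℕ :=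
  fun a => if (a : ℕ) < b then (J.elt a : ℕ) + 1 else 0

lemma exists_last_ne {p q : Fin k → ℕ} (h : p ≠ q) :
    ∃ a, p a ≠ q a ∧ ∀ c, a < c → p c = q c := by
  obtain ⟨a₀, ha₀⟩ := Function.ne_iff.1 h
  obtain ⟨a, ha, hmax⟩ := (univ.filter fun a => p a ≠ q a).exists_max_image id
    ⟨a₀, by simpa using ha₀⟩
  refine ⟨a, by simpa using ha, fun c hc => ?_⟩
  by_contra hne
  exact absurd (hmax c (by simpa using hne)) (not_le.2 hc)

/-- The extensions of initial segments by one more entry are rigid: if two noncrossing families of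
weights induce the same weights on initial segments of length `b` and on entries at position `b`,
then they induce the same weights on initial segments of length `b + 1`. The smallest entry where
they differ would have to be attached to two different initial segments, and the rest of the mass
of the later one then produces a crossing. -/
lemma initial_step {c d : KSubset k n → ℝ} (hc0 : ∀ J, 0 ≤ c J) (hd0 : ∀ J, 0 ≤ d J)
    (hc : ∀ I J, c I ≠ 0 → c J ≠ 0 → ¬ Crosses I J)
    (hd : ∀ I J, d I ≠ 0 → d J ≠ 0 → ¬ Crosses I J) (b : Fin k)
    (hpre : ∀ p, ∑ J with J.initial b = p, c J = ∑ J with J.initial b = p, d J)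
    (hval : ∀ v, ∑ J with J.elt b = v, c J = ∑ J with J.elt b = v, d J) (p : Fin k → ℕ) (v : Fin n) :
    ∑ J with J.initial b = p ∧ J.elt b = v, c J =
      ∑ J with J.initial b = p ∧ J.elt b = v, d J := by
  classical
  by_contra hne
  set F : (Fin k → ℕ) → Fin n → ℝ := fun p v =>
    ∑ J with J.initial b = p ∧ J.elt b = v, (c J - d J) with hF
  have hFne : F p v ≠ 0 := by
    simp only [hF, sum_sub_distrib]; exact sub_ne_zero.2 hne
  have hFpre : ∀ p, ∑ v, F p v = 0 := by
    intro p
    have := sum_fiberwise (univ.filter fun J : KSubset k n => J.initial b = p) (fun J => J.elt b)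
      (fun J => c J - d J)
    simp only [filter_filter] at this
    rw [hF]; dsimp only
    rw [this, sum_sub_distrib, hpre, sub_self]
  have hFval : ∀ v, ∑ p ∈ univ.image (fun J : KSubset k n => J.initial b), F p v = 0 := by
    intro v
    have := sum_fiberwise_of_maps_to (s := univ.filter fun J : KSubset k n => J.elt b = v)
      (t := univ.image (fun J : KSubset k n => J.initial b)) (g := fun J => J.initial b)
      (fun J _ => mem_image_of_mem _ (mem_univ J)) (fun J => c J - d J)
    simp only [filter_filter] at this
    rw [hF]; dsimp only
    simp only [and_comm (a := _ = v)] at this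
    rw [this, sum_sub_distrib, hval, sub_self]
  have hFpos : ∀ p v, 0 < F p v → ∃ J, J.initial b = p ∧ J.elt b = v ∧ c J ≠ 0 := by
    intro p v h
    obtain ⟨J, hJ, hpos⟩ := exists_lt_of_sum_lt (s := univ.filter fun J : KSubset k n =>
      J.initial b = p ∧ J.elt b = v) (f := fun _ => (0 : ℝ)) (g := fun J => c J - d J)
      (by rw [sum_const_zero]; exact h)
    rw [mem_filter] at hJ
    exact ⟨J, hJ.2.1, hJ.2.2, fun h0 => by have := hd0 J; rw [h0] at hpos; linarith⟩
  have hFneg : ∀ p v, F p v < 0 → ∃ J, J.initial b = p ∧ J.elt b = v ∧ d J ≠ 0 := by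
    intro p v h
    obtain ⟨J, hJ, hpos⟩ := exists_lt_of_sum_lt (s := univ.filter fun J : KSubset k n =>
      J.initial b = p ∧ J.elt b = v) (g := fun _ => (0 : ℝ)) (f := fun J => c J - d J)
      (by rw [sum_const_zero]; exact h)
    rw [mem_filter] at hJ
    exact ⟨J, hJ.2.1, hJ.2.2, fun h0 => by have := hc0 J; rw [h0] at hpos; linarith⟩
  -- the smallest entry at which the two families differ
  obtain ⟨v, hv, hmin⟩ := (univ.filter fun v : Fin n => ∃ p, F p v ≠ 0).exists_min_image id
    ⟨v, by simpa using ⟨p, hFne⟩⟩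
  have hmin' : ∀ w < v, ∀ p, F p w = 0 := by
    intro w hw p
    by_contra h
    exact absurd (hmin w (by simpa using ⟨p, h⟩)) (not_le.2 hw)
  obtain ⟨p₀, hp₀⟩ : ∃ p, F p v ≠ 0 := by simpa using hv
  have hp₀m : p₀ ∈ univ.image (fun J : KSubset k n => J.initial b) := by
    rcases lt_or_gt_of_ne hp₀ with h | h
    · obtain ⟨J, hJ, -⟩ := hFneg _ _ h; exact hJ ▸ mem_image_of_mem _ (mem_univ J)
    · obtain ⟨J, hJ, -⟩ := hFpos _ _ h; exact hJ ▸ mem_image_of_mem _ (mem_univ J)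
  obtain ⟨p, -, hp⟩ := exists_pos_of_sum_zero_of_exists_nonzero _ (hFval v) ⟨p₀, hp₀m, hp₀⟩
  obtain ⟨p', -, hp'⟩ : ∃ p' ∈ univ.image (fun J : KSubset k n => J.initial b), F p' v < 0 := by
    by_contra! h
    exact hp₀ ((sum_eq_zero_iff_of_nonneg h).1 (hFval v) p₀ hp₀m)
  obtain ⟨w, hw⟩ : ∃ w, F p w < 0 := by
    by_contra! h
    exact hp.ne' ((sum_eq_zero_iff_of_nonneg fun i _ => h i).1 (hFpre p) v (mem_univ _))
  obtain ⟨w', hw'⟩ : ∃ w, 0 < F p' w := by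
    by_contra! h
    exact hp'.ne ((sum_eq_zero_iff_of_nonpos fun i _ => h i).1 (hFpre p') v (mem_univ _))
  have hvw : v < w := by
    rcases lt_trichotomy w v with h | h | h
    · exact absurd (hmin' w h p) hw.ne
    · subst h; exact absurd hw hp.not_gt
    · exact h
  have hvw' : v < w' := by
    rcases lt_trichotomy w' v with h | h | h
    · exact absurd (hmin' w' h p') hw'.ne'
    · subst h; exact absurd hw' hp'.not_gt
    · exact h
  obtain ⟨A, hA1, hA2, hA3⟩ := hFpos _ _ hp
  obtain ⟨A', hA1', hA2', hA3'⟩ := hFneg _ _ hp'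
  obtain ⟨E, hE1, hE2, hE3⟩ := hFneg _ _ hw
  obtain ⟨E', hE1', hE2', hE3'⟩ := hFpos _ _ hw'
  have hpp : p ≠ p' := fun h => by subst h; exact absurd hp hp'.not_gt
  -- an initial segment that closes early although a later one is still open gives a crossing
  have hcross : ∀ I J L : KSubset k n, ∀ a, I.initial b a < J.initial b a →
      (∀ e, a < e → I.initial b e = J.initial b e) → L.initial b = J.initial b →
      L.elt b = I.elt b → I.elt b < J.elt b → Crosses I J := by
    intro I J L a ha hae hL hLb hIJ
    have hab : a < b := by
      by_contra h
      simp [KSubset.initial, show ¬ (a : ℕ) < b from h] at ha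
    have hin : ∀ (X Y : KSubset k n) (e : Fin k), e < b → X.initial b e = Y.initial b e →
        X.elt e = Y.elt e := by
      intro X Y e he h
      simp only [KSubset.initial, if_pos (Fin.lt_def.1 he)] at h
      exact Fin.ext (by omega)
    refine ⟨a, b, hab, fun e h1 h2 => hin I J e h2 (hae e h1), ?_, ?_, hIJ⟩
    · simp only [KSubset.initial, if_pos (Fin.lt_def.1 hab)] at ha
      rw [Fin.lt_def]; omega
    · rw [← hin L J a hab (congrFun hL a), ← hLb]
      exact L.elt_strictMono hab
  obtain ⟨a, ha, hae⟩ := exists_last_ne hpp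
  rcases lt_or_gt_of_ne ha with h | h
  · refine hc A E' hA3 hE3' (hcross A E' A' a ?_ ?_ ?_ ?_ ?_)
    · rwa [hA1, hE1']
    · rwa [hA1, hE1']
    · rw [hA1', hE1']
    · rw [hA2', hA2]
    · rwa [hA2, hE2']
  · refine hd A' E hA3' hE3 (hcross A' E A a ?_ ?_ ?_ ?_ ?_)
    · rwa [hA1', hE1]
    · rw [hA1', hE1]; exact fun e he => (hae e he).symm
    · rw [hA1, hE1]
    · rw [hA2', hA2]
    · rwa [hA2', hE2]

lemma initial_eq_iff (I J : KSubset k n) (b : ℕ) :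
    I.initial b = J.initial b ↔ ∀ a : Fin k, (a : ℕ) < b → I.elt a = J.elt a := by
  constructor
  · intro h a ha
    have := congrFun h a
    simp only [KSubset.initial, if_pos ha] at this
    exact Fin.ext (by omega)
  · intro h
    funext a
    by_cases ha : (a : ℕ) < b
    · simp [KSubset.initial, ha, h a ha]
    · simp [KSubset.initial, ha]

/-- Two noncrossing families of weights with the same distribution of entries at each position
are equal. -/
lemma eq_of_marginals {c d : KSubset k n → ℝ} (hc0 : ∀ J, 0 ≤ c J) (hd0 : ∀ J, 0 ≤ d J)
    (hc : ∀ I J, c I ≠ 0 → c J ≠ 0 → Noncrossing I J)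
    (hd : ∀ I J, d I ≠ 0 → d J ≠ 0 → Noncrossing I J)
    (htot : ∑ J, c J = ∑ J, d J)
    (hval : ∀ (b : Fin k) v, ∑ J with J.elt b = v, c J = ∑ J with J.elt b = v, d J) : c = d := by
  classical
  have key : ∀ b : ℕ, b ≤ k → ∀ p, ∑ J with KSubset.initial J b = p, c J =
      ∑ J with KSubset.initial J b = p, d J := by
    intro b
    induction b with
    | zero =>
      intro _ p
      have h0 : ∀ J : KSubset k n, J.initial 0 = 0 := by
        intro J; funext a; simp [KSubset.initial]
      simp only [h0]
      by_cases hp : 0 = p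
      · simpa [hp] using htot
      · simp [hp]
    | succ b ih =>
      intro hb p
      have hstep := initial_step hc0 hd0 (fun I J h1 h2 => ((noncrossing_iff I J).1 (hc I J h1 h2)).1)
        (fun I J h1 h2 => ((noncrossing_iff I J).1 (hd I J h1 h2)).1) ⟨b, hb⟩ (ih (by omega))
        (hval _)
      by_cases hp : ∃ L : KSubset k n, L.initial (b + 1) = p
      · obtain ⟨L, rfl⟩ := hp
        have : ∀ J : KSubset k n, J.initial (b + 1) = L.initial (b + 1) ↔
            J.initial b = L.initial b ∧ J.elt ⟨b, hb⟩ = L.elt ⟨b, hb⟩ := by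
          intro J
          rw [initial_eq_iff, initial_eq_iff]
          constructor
          · exact fun h => ⟨fun a ha => h a (by omega), h _ (by simp)⟩
          · rintro ⟨h1, h2⟩ a ha
            rcases Nat.lt_succ_iff_lt_or_eq.1 ha with h | h
            · exact h1 a h
            · have : a = ⟨b, hb⟩ := Fin.ext h
              rw [this, h2]
        simp only [this]
        exact hstep _ _
      · push Not at hp
        simp [hp]
  funext L
  have h := key k le_rfl (L.initial k)
  have : ∀ J : KSubset k n, J.initial k = L.initial k ↔ J = L := by
    intro J
    rw [initial_eq_iff]
    exact ⟨fun h => KSubset.ext_elt fun r => h r r.2, fun h => by simp [h]⟩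
  simpa [this, filter_eq'] using h

/-- The vector `(1, tTilde J)`, which records `tTilde J` as a point at height one. -/
def lifted (J : KSubset k n) : ℝ × TTilde k n := (1, tTilde J)

lemma sum_smul_lifted (c : KSubset k n → ℝ) :
    ∑ J, c J • lifted J = (∑ J, c J, ∑ J, c J • tTilde J) := by
  simp [lifted, Prod.ext_iff, Prod.fst_sum, Prod.snd_sum]

/-- A point has at most one decomposition into pairwise noncrossing vertices. -/
lemma noncrossing_unique {c d : KSubset k n → ℝ} (hc0 : ∀ J, 0 ≤ c J) (hd0 : ∀ J, 0 ≤ d J)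
    (hc : ∀ I J, c I ≠ 0 → c J ≠ 0 → Noncrossing I J)
    (hd : ∀ I J, d I ≠ 0 → d J ≠ 0 → Noncrossing I J)
    (h : ∑ J, c J • lifted J = ∑ J, d J • lifted J) : c = d := by
  classical
  rw [sum_smul_lifted, sum_smul_lifted, Prod.mk.injEq] at h
  obtain ⟨htot, hvec⟩ := h
  -- the coordinates determine the mass of the subsets whose `r`-th entry is at least `x`
  have htail : ∀ (r : Fin k) (x : ℕ), ∑ J with x ≤ (KSubset.elt J r : ℕ), c J =
      ∑ J with x ≤ (KSubset.elt J r : ℕ), d J := by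
    intro r x
    rcases le_or_gt x r with hx | hx
    · have : ∀ J : KSubset k n, x ≤ (J.elt r : ℕ) := fun J => hx.trans (J.le_elt r)
      simpa [this] using htot
    rcases lt_or_ge x (n - k + r + 1) with hx' | hx'
    · have := congrFun (congrFun hvec r) ⟨x - r - 1, by omega⟩
      simp only [Finset.sum_apply, Pi.smul_apply, tTilde_apply, smul_eq_mul, mul_ite, mul_one,
        mul_zero] at this
      rw [sum_filter, sum_filter]
      have e : ∀ J : KSubset k n, (x - r - 1 + r < (J.elt r : ℕ)) = (x ≤ (J.elt r : ℕ)) := by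
        intro J; apply propext; omega
      simpa only [e] using this
    · have : ∀ J : KSubset k n, ¬ x ≤ (J.elt r : ℕ) := fun J => by
        have := J.elt_lt r; omega
      simp [this]
  refine eq_of_marginals hc0 hd0 hc hd htot fun r v => ?_
  have split : ∀ c : KSubset k n → ℝ, ∑ J with KSubset.elt J r = v, c J =
      ∑ J with (v : ℕ) ≤ (KSubset.elt J r : ℕ), c J -
        ∑ J with (v : ℕ) + 1 ≤ (KSubset.elt J r : ℕ), c J := by
    intro c
    rw [sum_filter, sum_filter, sum_filter, ← sum_sub_distrib]
    refine sum_congr rfl fun J _ => ?_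
    rw [if_congr (Fin.ext_iff (a := KSubset.elt J r) (b := v)) rfl rfl]
    split_ifs <;> first | omega | simp
  rw [split, split, htail, htail]

/-! ### Uniqueness of nonnegative decompositions -/

section Unique

variable {E W : Type*} [Fintype E] [AddCommGroup W] [Module ℝ W]

/-- Nonnegative combinations of the vectors `u J` whose supports belong to `𝒦` are determined by
their values. -/
def UniqueDecomposition (u : E → W) (𝒦 : Set (Set E)) : Prop :=
  ∀ c d : E → ℝ, (∀ J, 0 ≤ c J) → (∀ J, 0 ≤ d J) → Function.support c ∈ 𝒦 →
    Function.support d ∈ 𝒦 → ∑ J, c J • u J = ∑ J, d J • u J → c = d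

variable {u : E → W} {𝒦 : Set (Set E)}

lemma UniqueDecomposition.eq_zero (hu : UniqueDecomposition u 𝒦) (hlow : IsLowerSet 𝒦) {K : Set E}
    (hK : K ∈ 𝒦) {g : E → ℝ} (hg : Function.support g ⊆ K) (h0 : ∑ J, g J • u J = 0) : g = 0 := by
  have h := hu (fun J => max (g J) 0) (fun J => max (-g J) 0) (fun J => le_max_right _ _)
    (fun J => le_max_right _ _)
    (hlow (fun J hJ => hg fun h => hJ (by simp [h])) hK)
    (hlow (fun J hJ => hg fun h => hJ (by simp [h])) hK) (by
      rw [← sub_eq_zero, ← sum_sub_distrib, ← h0]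
      refine sum_congr rfl fun J _ => ?_
      rw [← sub_smul, max_zero_sub_max_neg_zero_eq_self])
  funext J
  have := congrFun h J
  rw [← max_zero_sub_max_neg_zero_eq_self (g J)]
  exact sub_eq_zero.2 this

lemma linearIndepOn_of_forall_eq_zero {K : Set E}
    (h : ∀ g : E → ℝ, Function.support g ⊆ K → ∑ J, g J • u J = 0 → g = 0) :
    LinearIndepOn ℝ u K := by
  rw [linearIndepOn_iff]
  intro l hl h0
  rw [Finsupp.linearCombination_apply,
    Finsupp.sum_fintype l (fun i a => a • u i) (fun _ => zero_smul _ _)] at h0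
  refine DFunLike.coe_injective (h l (fun J hJ => ?_) h0)
  exact (Finsupp.mem_supported _ _).1 hl (by simpa using hJ)

lemma UniqueDecomposition.linearIndepOn (hu : UniqueDecomposition u 𝒦) (hlow : IsLowerSet 𝒦)
    {K : Set E} (hK : K ∈ 𝒦) : LinearIndepOn ℝ u K :=
  linearIndepOn_of_forall_eq_zero fun _ hg h0 => hu.eq_zero hlow hK hg h0

end Unique

/-! ### Decompositions of minimal height -/

/-- A closed set of nonnegative reals that can serve as coefficients in decompositions: it is closed
under addition, and a common positive amount can be taken away from two positive members. The
nonnegative reals and the natural numbers are the two examples. -/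
structure IsCoefficientSet (G : Set ℝ) : Prop where
  isClosed : IsClosed G
  nonneg : ∀ x ∈ G, 0 ≤ x
  zero_mem : 0 ∈ G
  add_mem : ∀ x ∈ G, ∀ y ∈ G, x + y ∈ G
  exists_sub : ∀ x ∈ G, ∀ y ∈ G, 0 < x → 0 < y → ∃ ε ∈ G, 0 < ε ∧ x - ε ∈ G ∧ y - ε ∈ G

lemma isCoefficientSet_nonneg : IsCoefficientSet (Set.Ici 0) where
  isClosed := isClosed_Ici
  nonneg _ hx := hx
  zero_mem := Set.mem_Ici.2 le_rfl
  add_mem _ hx _ hy := Set.mem_Ici.2 (add_nonneg hx hy)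
  exists_sub x _ y _ hx hy := ⟨min x y, (lt_min hx hy).le, lt_min hx hy,
    Set.mem_Ici.2 (sub_nonneg.2 (min_le_left _ _)), Set.mem_Ici.2 (sub_nonneg.2 (min_le_right _ _))⟩

lemma isCoefficientSet_nat : IsCoefficientSet (Set.range (Nat.cast : ℕ → ℝ)) where
  isClosed := Nat.isClosedEmbedding_coe_real.isClosed_range
  nonneg := by rintro _ ⟨m, rfl⟩; exact Nat.cast_nonneg m
  zero_mem := ⟨0, Nat.cast_zero⟩
  add_mem := by rintro _ ⟨m, rfl⟩ _ ⟨l, rfl⟩; exact ⟨m + l, Nat.cast_add m l⟩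
  exists_sub := by
    rintro _ ⟨m, rfl⟩ _ ⟨l, rfl⟩ hm hl
    have hm' : 1 ≤ m := Nat.one_le_iff_ne_zero.2 (by rintro rfl; simp at hm)
    have hl' : 1 ≤ l := Nat.one_le_iff_ne_zero.2 (by rintro rfl; simp at hl)
    exact ⟨1, ⟨1, Nat.cast_one⟩, one_pos, ⟨m - 1, by push_cast [hm']; ring⟩,
      ⟨l - 1, by push_cast [hl']; ring⟩⟩

/-- The sets of pairwise compatible elements. -/
def cliques {E : Type*} (compat : E → E → Prop) : Set (Set E) :=
  {K | ∀ I ∈ K, ∀ J ∈ K, compat I J}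

lemma isLowerSet_cliques {E : Type*} (compat : E → E → Prop) : IsLowerSet (cliques compat) :=
  fun _ _ hLK hK I hI J hJ => hK I (hLK hI) J (hLK hJ)

lemma exists_maximal_clique {E : Type*} [Finite E] {compat : E → E → Prop} {K : Set E}
    (hK : K ∈ cliques compat) : ∃ L, K ⊆ L ∧ Maximal (· ∈ cliques compat) L :=
  (Set.toFinite (cliques compat)).exists_le_maximal hK

/-- Points `u J` at height one for a linear functional `deg`, a compatibility relation and heights
such that every incompatible pair can be exchanged for a pair with the same sum and smaller total
height, while decompositions with compatible supports are unique. -/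
structure ExchangeSystem {E W : Type*} [Fintype E] [AddCommGroup W] [Module ℝ W] (u : E → W)
    (compat : E → E → Prop) (ω : E → ℝ) (deg : W →ₗ[ℝ] ℝ) : Prop where
  refl : ∀ J, compat J J
  deg_eq : ∀ J, deg (u J) = 1
  exchange : ∀ I J, ¬ compat I J →
    ∃ I' J', u I + u J = u I' + u J' ∧ ω I' + ω J' < ω I + ω J
  unique : UniqueDecomposition u (cliques compat)

namespace ExchangeSystem

variable {E W : Type*} [Fintype E] [NormedAddCommGroup W] [NormedSpace ℝ W] {u : E → W}
  {compat : E → E → Prop} {ω : E → ℝ} {deg : W →ₗ[ℝ] ℝ}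

lemma deg_sum (h : ExchangeSystem u compat ω deg) (c : E → ℝ) :
    deg (∑ J, c J • u J) = ∑ J, c J := by
  simp [map_sum, h.deg_eq]

/-- A decomposition with an incompatible pair in its support does not have minimal height. -/
lemma exists_lower (h : ExchangeSystem u compat ω deg) {G : Set ℝ} (hG : IsCoefficientSet G)
    {c : E → ℝ} (hc : ∀ J, c J ∈ G) (hs : Function.support c ∉ cliques compat) :
    ∃ c' : E → ℝ, (∀ J, c' J ∈ G) ∧ ∑ J, c' J • u J = ∑ J, c J • u J ∧
      ∑ J, c' J * ω J < ∑ J, c J * ω J := by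
  classical
  simp only [cliques, Set.mem_ofPred_eq, not_forall] at hs
  obtain ⟨I, hI, J, hJ, hIJ⟩ := hs
  have hne : I ≠ J := by rintro rfl; exact hIJ (h.refl I)
  obtain ⟨ε, hεG, hε, h1, h2⟩ := hG.exists_sub _ (hc I) _ (hc J)
    (lt_of_le_of_ne (hG.nonneg _ (hc I)) (Ne.symm hI))
    (lt_of_le_of_ne (hG.nonneg _ (hc J)) (Ne.symm hJ))
  obtain ⟨I', J', hu, hω⟩ := h.exchange I J hIJ
  refine ⟨fun L => (c L - (if L = I then ε else 0) - (if L = J then ε else 0)) +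
    (if L = I' then ε else 0) + (if L = J' then ε else 0), fun L => ?_, ?_, ?_⟩
  · have hite : ∀ p : Prop, [Decidable p] → (if p then ε else 0) ∈ G := by
      intro p _; split_ifs; exacts [hεG, hG.zero_mem]
    refine hG.add_mem _ (hG.add_mem _ ?_ _ (hite _)) _ (hite _)
    by_cases hL : L = I
    · subst hL; simpa [hne] using h1
    · by_cases hL' : L = J
      · subst hL'; simpa [hL] using h2
      · simpa [hL, hL'] using hc L
  · simp only [add_smul, sub_smul, sum_add_distrib, sum_sub_distrib, ite_smul, zero_smul,
      sum_ite_eq', mem_univ, if_true]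
    have : ε • u I + ε • u J = ε • u I' + ε • u J' := by rw [← smul_add, hu, smul_add]
    rw [sub_sub, this]; abel
  · simp only [add_mul, sub_mul, sum_add_distrib, sum_sub_distrib, ite_mul, zero_mul,
      sum_ite_eq', mem_univ, if_true]
    nlinarith

/-- Every nonnegative combination can be rewritten with a compatible support; unless the support
was compatible already, this lowers the height. -/
lemma exists_compatible (h : ExchangeSystem u compat ω deg) {G : Set ℝ} (hG : IsCoefficientSet G)
    {c : E → ℝ} (hc : ∀ J, c J ∈ G) :
    ∃ c' : E → ℝ, (∀ J, c' J ∈ G) ∧ ∑ J, c' J • u J = ∑ J, c J • u J ∧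
      Function.support c' ∈ cliques compat ∧
      (Function.support c ∉ cliques compat → ∑ J, c' J * ω J < ∑ J, c J * ω J) := by
  set S : Set (E → ℝ) := {c' | (∀ J, c' J ∈ G) ∧ ∑ J, c' J • u J = ∑ J, c J • u J} with hS
  have hclosed : IsClosed S := by
    have : S = (⋂ J, {c' : E → ℝ | c' J ∈ G}) ∩ {c' | ∑ J, c' J • u J = ∑ J, c J • u J} := by
      ext; simp [hS]
    rw [this]
    exact (isClosed_iInter fun J => hG.isClosed.preimage (continuous_apply J)).inter
      (isClosed_eq (by fun_prop) continuous_const)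
  have hbdd : S ⊆ Set.Icc 0 (fun _ => ∑ J, c J) := by
    rintro c' ⟨h1, h2⟩
    have h3 := congrArg deg h2
    rw [h.deg_sum, h.deg_sum] at h3
    exact ⟨fun J => hG.nonneg _ (h1 J), fun J => by
      dsimp only
      rw [← h3]
      exact single_le_sum (f := c') (fun L _ => hG.nonneg _ (h1 L)) (mem_univ J)⟩
  obtain ⟨c', ⟨h1, h2⟩, hmin⟩ := (isCompact_Icc.of_isClosed_subset hclosed hbdd).exists_isMinOn
    ⟨c, hc, rfl⟩ (f := fun c' => ∑ J, c' J * ω J)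
    (Continuous.continuousOn (by fun_prop))
  refine ⟨c', h1, h2, ?_, fun hs => ?_⟩
  · by_contra hs
    obtain ⟨d, d1, d2, d3⟩ := h.exists_lower hG h1 hs
    exact absurd (hmin (show d ∈ S from ⟨d1, d2.trans h2⟩)) (not_le.2 d3)
  · obtain ⟨d, d1, d2, d3⟩ := h.exists_lower hG hc hs
    exact (hmin (show d ∈ S from ⟨d1, d2⟩)).trans_lt d3

/-- If `K` is a maximal clique, then adding any `u P` to a large multiple of the sum of the `u J`,
`J ∈ K`, produces a point that still lies in the cone of `K`, with integral coefficients: the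
rescaled compatible decompositions of these points accumulate at a decomposition of the
sum of the `u J`, which is unique, so that their supports eventually contain `K`. -/
lemma exists_sum_add_eq (h : ExchangeSystem u compat ω deg) {K : Set E}
    (hK : Maximal (· ∈ cliques compat) K) (P : E) :
    ∃ (M : ℕ) (c : E → ℕ), Function.support c ⊆ K ∧
      ∑ J, (c J : ℝ) • u J = ∑ J, ((M : ℝ) * K.indicator 1 J) • u J + u P ∧
      (P ∉ K → ∑ J, (c J : ℝ) * ω J < ∑ J, ((M : ℝ) * K.indicator 1 J) * ω J + ω P) := by
  classical
  set χ : E → ℝ := K.indicator 1 with hχ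
  have hχs : Function.support χ = K := by rw [hχ]; simp [Set.support_indicator, Function.support_one]
  have hχ0 : ∀ J, 0 ≤ χ J := fun J => Set.indicator_nonneg (fun _ _ => zero_le_one) J
  set base : ℕ → E → ℝ := fun M J => ((M + 1 : ℕ) : ℝ) * χ J + if J = P then 1 else 0 with hbase
  have hb : ∀ M J, base M J ∈ Set.range (Nat.cast : ℕ → ℝ) := by
    intro M J
    refine ⟨(M + 1) * (if J ∈ K then 1 else 0) + if J = P then 1 else 0, ?_⟩
    simp [hbase, hχ, Set.indicator_apply]
  have hbu : ∀ M, ∑ J, base M J • u J = ∑ J, (((M + 1 : ℕ) : ℝ) * χ J) • u J + u P := by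
    intro M
    simp [hbase, add_smul, sum_add_distrib, ite_smul]
  have hbω : ∀ M, ∑ J, base M J * ω J = ∑ J, (((M + 1 : ℕ) : ℝ) * χ J) * ω J + ω P := by
    intro M
    simp [hbase, add_mul, sum_add_distrib, ite_mul]
  choose c hcG hcu hcs hcω using fun M => h.exists_compatible isCoefficientSet_nat (hb M)
  have hc0 : ∀ M J, 0 ≤ c M J := fun M J => isCoefficientSet_nat.nonneg _ (hcG M J)
  have hpos : ∀ M : ℕ, (0 : ℝ) < ((M + 1 : ℕ) : ℝ) := fun M => by positivity
  set x : ℕ → E → ℝ := fun M J => (((M + 1 : ℕ) : ℝ))⁻¹ * c M J with hx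
  have hxu : ∀ M : ℕ, ∑ J, x M J • u J = ∑ J, χ J • u J + (1 / ((M : ℝ) + 1)) • u P := by
    intro M
    simp only [hx, mul_smul, ← smul_sum]
    rw [hcu, hbu, smul_add]
    simp only [mul_smul, ← smul_sum]
    rw [inv_smul_smul₀ (hpos M).ne', one_div]
    push_cast; rfl
  have hxmem : ∀ M, x M ∈ Set.Icc (0 : E → ℝ) (fun _ => ∑ J, χ J + 1) := by
    intro M
    have hx0 : ∀ J, 0 ≤ x M J := fun J => mul_nonneg (inv_nonneg.2 (hpos M).le) (hc0 M J)
    refine ⟨hx0, fun J => (single_le_sum (f := x M) (fun L _ => hx0 L) (mem_univ J)).trans ?_⟩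
    have h3 := congrArg deg (hxu M)
    rw [map_add, map_smul, h.deg_eq, h.deg_sum, h.deg_sum, smul_eq_mul, mul_one] at h3
    rw [h3]
    have : 1 / ((M : ℝ) + 1) ≤ 1 := by
      rw [div_le_one (by positivity)]; linarith [(Nat.cast_nonneg M : (0 : ℝ) ≤ M)]
    linarith
  obtain ⟨y, hy, φ, hφ, hlim⟩ := isCompact_Icc.tendsto_subseq hxmem
  have hlimJ : ∀ J, Tendsto (fun i => x (φ i) J) atTop (𝓝 (y J)) := fun J =>
    ((continuous_apply J).tendsto y).comp hlim
  have hyu : ∑ J, y J • u J = ∑ J, χ J • u J := by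
    have t1 : Tendsto (fun i => ∑ J, x (φ i) J • u J) atTop (𝓝 (∑ J, y J • u J)) :=
      tendsto_finsetSum _ fun J _ => (hlimJ J).smul_const _
    have t2 : Tendsto (fun i => ∑ J, x (φ i) J • u J) atTop (𝓝 (∑ J, χ J • u J + (0 : ℝ) • u P)) := by
      simp only [hxu]
      exact tendsto_const_nhds.add
        ((tendsto_one_div_add_atTop_nhds_zero_nat.comp hφ.tendsto_atTop).smul_const _)
    rw [zero_smul, add_zero] at t2
    exact tendsto_nhds_unique t1 t2
  have hxc : ∀ M J, x M J ≠ 0 → c M J ≠ 0 := fun M J hne h0 => hne (by simp [hx, h0])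
  have hys : Function.support y ∈ cliques compat := by
    intro I hI J hJ
    obtain ⟨i, h1, h2⟩ := (((hlimJ I).eventually_ne hI).and ((hlimJ J).eventually_ne hJ)).exists
    exact hcs (φ i) I (hxc _ _ h1) J (hxc _ _ h2)
  have hyχ : y = χ := h.unique y χ (fun J => hy.1 J) hχ0 hys (by rw [hχs]; exact hK.prop) hyu
  obtain ⟨i, hi⟩ : ∃ i, ∀ J, J ∈ K → x (φ i) J ≠ 0 := by
    refine (eventually_all.2 fun J => ?_ : ∀ᶠ i in atTop, ∀ J, J ∈ K → x (φ i) J ≠ 0).exists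
    by_cases hJ : J ∈ K
    · have : y J ≠ 0 := by
        rw [hyχ]; rw [← hχs] at hJ; exact hJ
      filter_upwards [(hlimJ J).eventually_ne this] with i hi _ using hi
    · exact Eventually.of_forall fun _ h => absurd h hJ
  have hKs : K ⊆ Function.support (c (φ i)) := fun J hJ => hxc _ _ (hi J hJ)
  choose m hm using hcG (φ i)
  refine ⟨φ i + 1, m, ?_, ?_, fun hP => ?_⟩
  · refine Set.Subset.trans (fun J hJ => ?_) (hK.le_of_ge (hcs (φ i)) hKs)
    rw [Function.mem_support, ← hm]; exact_mod_cast hJ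
  · simp only [hm]; rw [hcu, hbu]
  · simp only [hm]; rw [← hbω]
    refine hcω _ fun hs => hP ?_
    refine hK.le_of_ge (y := Function.support (base (φ i))) hs (fun J hJ => ?_) ?_
    · have : 0 < χ J := lt_of_le_of_ne (hχ0 J) (Ne.symm (by rw [← hχs] at hJ; exact hJ))
      have := mul_pos (hpos (φ i)) this
      simp only [hbase, Function.mem_support]
      split_ifs <;> positivity
    · have := mul_nonneg (hpos (φ i)).le (hχ0 P)
      simp only [hbase, Function.mem_support, if_true]
      positivity

/-- The vectors of a maximal clique generate all others over the integers. -/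
lemma mem_span_int (h : ExchangeSystem u compat ω deg) {K : Set E}
    (hK : Maximal (· ∈ cliques compat) K) (P : E) : u P ∈ Submodule.span ℤ (u '' K) := by
  classical
  obtain ⟨M, c, hc, hsum, -⟩ := h.exists_sum_add_eq hK P
  rw [← sub_eq_iff_eq_add'] at hsum
  rw [← hsum]
  refine Submodule.sub_mem _ (Submodule.sum_mem _ fun J _ => ?_) (Submodule.sum_mem _ fun J _ => ?_)
  · by_cases hJ : J ∈ K
    · rw [Nat.cast_smul_eq_nsmul]
      exact nsmul_mem (Submodule.subset_span (Set.mem_image_of_mem u hJ)) _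
    · have : c J = 0 := by by_contra h'; exact hJ (hc h')
      simp [this]
  · by_cases hJ : J ∈ K
    · simp only [Set.indicator_of_mem hJ, Pi.one_apply, mul_one]
      rw [Nat.cast_smul_eq_nsmul]
      exact nsmul_mem (Submodule.subset_span (Set.mem_image_of_mem u hJ)) _
    · simp [Set.indicator_of_notMem hJ]

/-- Values at the vectors of a clique extend to linear functionals. -/
lemma exists_functional (h : ExchangeSystem u compat ω deg) {K : Set E}
    (hK : K ∈ cliques compat) (a : E → ℝ) : ∃ f : W →ₗ[ℝ] ℝ, ∀ J ∈ K, f (u J) = a J := by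
  have hli := h.unique.linearIndepOn (isLowerSet_cliques _) hK
  obtain ⟨f, hf⟩ := LinearMap.exists_extend
    ((Module.Basis.span hli).constr ℝ fun J : K => a J)
  refine ⟨f, fun J hJ => ?_⟩
  have h1 := congrArg (fun g => g ((Module.Basis.span hli) ⟨J, hJ⟩)) hf
  simp only [Module.Basis.constr_basis, LinearMap.comp_apply] at h1
  rw [← h1]
  exact congrArg f (Module.Basis.coe_span_apply hli ⟨J, hJ⟩).symm

/-- Every clique is cut out of the lower hull of the heights by a linear functional. For a maximal
clique `K` the functional interpolating the heights on `K` works, since the decomposition of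
`exists_sum_add_eq` has smaller height than the incompatible one it replaces; for smaller cliques
this functional is tilted slightly. -/
lemma exists_supporting (h : ExchangeSystem u compat ω deg) {K : Set E}
    (hK : K ∈ cliques compat) :
    ∃ f : W →ₗ[ℝ] ℝ, (∀ J, f (u J) ≤ ω J) ∧ ∀ J, f (u J) = ω J ↔ J ∈ K := by
  classical
  obtain ⟨L, hKL, hL⟩ := exists_maximal_clique hK
  obtain ⟨g, hg⟩ := h.exists_functional hL.prop ω
  obtain ⟨t, ht⟩ := h.exists_functional hL.prop fun J => if J ∈ K then 0 else 1
  have hlt : ∀ P, P ∉ L → g (u P) < ω P := by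
    intro P hP
    obtain ⟨M, c, hc, hsum, hω⟩ := h.exists_sum_add_eq hL P
    have h1 := congrArg g hsum
    simp only [map_add, map_sum, map_smul, smul_eq_mul] at h1
    have e1 : ∑ J, (c J : ℝ) * g (u J) = ∑ J, (c J : ℝ) * ω J := by
      refine sum_congr rfl fun J _ => ?_
      by_cases hJ : J ∈ L
      · rw [hg J hJ]
      · have : c J = 0 := by by_contra h'; exact hJ (hc h')
        simp [this]
    have e2 : ∑ J, (M : ℝ) * L.indicator 1 J * g (u J) = ∑ J, (M : ℝ) * L.indicator 1 J * ω J := by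
      refine sum_congr rfl fun J _ => ?_
      by_cases hJ : J ∈ L
      · rw [hg J hJ]
      · simp [Set.indicator_of_notMem hJ]
    have := hω hP
    rw [e1, e2] at h1
    linarith
  obtain ⟨ε, hε, hεpos⟩ : ∃ ε : ℝ, (∀ P, P ∉ L → g (u P) - ε * t (u P) < ω P) ∧ 0 < ε := by
    have hev : ∀ᶠ ε in 𝓝[>] (0 : ℝ), ∀ P, P ∉ L → g (u P) - ε * t (u P) < ω P := by
      refine eventually_all.2 fun P => ?_
      by_cases hP : P ∈ L
      · exact Eventually.of_forall fun _ h' => absurd hP h'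
      · have t1 : Tendsto (fun ε : ℝ => g (u P) - ε * t (u P)) (𝓝[>] 0)
            (𝓝 (g (u P) - 0 * t (u P))) :=
          (Continuous.tendsto (by fun_prop) (0 : ℝ)).mono_left nhdsWithin_le_nhds
        rw [zero_mul, sub_zero] at t1
        filter_upwards [t1.eventually_lt_const (hlt P hP)] with ε hε _ using hε
    obtain ⟨ε, h1, h2⟩ := (hev.and self_mem_nhdsWithin).exists
    exact ⟨ε, h1, h2⟩
  have hval : ∀ J, (g - ε • t) (u J) = g (u J) - ε * t (u J) := fun J => by simp
  refine ⟨g - ε • t, fun J => ?_, fun J => ?_⟩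
  · rw [hval]
    by_cases hJ : J ∈ L
    · rw [hg J hJ, ht J hJ]; split_ifs <;> linarith
    · exact (hε J hJ).le
  · rw [hval]
    by_cases hJ : J ∈ L
    · rw [hg J hJ, ht J hJ]
      split_ifs with hJK
      · simp [hJK]
      · simp [hJK, hεpos.ne']
    · exact iff_of_false (hε J hJ).ne fun h' => hJ (hKL h')

/-- Conversely, the points where a linear functional below the heights touches them form a
clique. -/
lemma mem_cliques_of_supporting (h : ExchangeSystem u compat ω deg) (f : W →ₗ[ℝ] ℝ)
    (hf : ∀ J, f (u J) ≤ ω J) : {J | f (u J) = ω J} ∈ cliques compat := by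
  intro I hI J hJ
  by_contra hIJ
  obtain ⟨I', J', h1, h2⟩ := h.exchange I J hIJ
  have := congrArg f h1
  rw [map_add, map_add, hI, hJ] at this
  linarith [hf I', hf J']

end ExchangeSystem

/-! ### Cyclic intervals -/

/-- The increasing sequence of a cyclic interval either has no gap at all, or is made of an initial
and a final segment of `[n]`. -/
lemma elt_of_isCyclicInterval (hkn : k < n) {J : KSubset k n} (hJ : IsCyclicInterval J.1) :
    (∃ a : ℕ, ∀ r, (J.elt r : ℕ) = a + r) ∨
      ∃ c : ℕ, ∀ r, (J.elt r : ℕ) = if (r : ℕ) < c then (r : ℕ) else n - k + r := by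
  obtain ⟨a, m, h⟩ := hJ
  have hn : 0 < n := by omega
  have ha : a % n < n := Nat.mod_lt _ hn
  have h' : ∀ x : Fin n, ∀ t < m, (x : ℕ) = (a % n + t) % n → x ∈ J.1 := by
    intro x t ht hx
    rw [Nat.mod_add_mod] at hx
    exact (h x).2 ⟨t, ht, hx⟩
  have hkm : k ≤ m := by
    have hsub : J.1.image (fun x : Fin n => (x : ℕ)) ⊆ (range m).image fun t => (a + t) % n := by
      intro y hy
      obtain ⟨x, hx, rfl⟩ := mem_image.1 hy
      obtain ⟨t, ht, hxt⟩ := (h x).1 hx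
      exact mem_image.2 ⟨t, mem_range.2 ht, hxt.symm⟩
    have := (card_le_card hsub).trans card_image_le
    rwa [card_image_of_injective _ Fin.val_injective, J.2, card_range] at this
  have huniq : ∀ f : Fin k → Fin n, (∀ r, f r ∈ J.1) → StrictMono f → ∀ r, J.elt r = f r :=
    fun f h1 h2 r => (congrFun (orderEmbOfFin_unique J.2 h1 h2) r).symm
  rcases le_or_gt (a % n + m) n with hm | hm
  · refine Or.inl ⟨a % n, fun r => ?_⟩
    rw [huniq (fun r => ⟨a % n + r, by have := r.2; omega⟩) (fun r => ?_) (fun r s hrs => ?_)]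
    · refine h' _ r (by have := r.2; omega) ?_
      have := r.2
      rw [Nat.mod_eq_of_lt (show a % n + r < n by omega)]
    · rw [Fin.lt_def] at *; dsimp only; omega
  · refine Or.inr ⟨a % n + m - n, fun r => ?_⟩
    rw [huniq (fun r => ⟨if (r : ℕ) < a % n + m - n then r else n - k + r, by
      have := r.2; split_ifs <;> omega⟩) (fun r => ?_) (fun r s hrs => ?_)]
    · have := r.2
      by_cases hr : (r : ℕ) < a % n + m - n
      · refine h' _ (n - a % n + r) (by omega) ?_
        rw [show a % n + (n - a % n + r) = r + n by omega, Nat.add_mod_right,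
          Nat.mod_eq_of_lt (show (r : ℕ) < n by omega)]
        exact if_pos hr
      · refine h' _ (n - k + r - a % n) (by omega) ?_
        rw [show a % n + (n - k + r - a % n) = n - k + r by omega,
          Nat.mod_eq_of_lt (show n - k + (r : ℕ) < n by omega)]
        exact if_neg hr
    · rw [Fin.lt_def] at *; dsimp only; split_ifs <;> omega

/-- A cyclic interval does not cross any other subset: the strict interleaving at the two ends of a
crossing would have to happen at gaps of the interval. -/
lemma noncrossing_of_isCyclicInterval (hkn : k < n) {J : KSubset k n} (hJ : IsCyclicInterval J.1)
    (I : KSubset k n) : Noncrossing I J := by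
  rw [noncrossing_iff]
  have hshape := elt_of_isCyclicInterval hkn hJ
  constructor
  · rintro ⟨a, b, hab, hM, h1, h2, h3⟩
    have hab' := Fin.lt_def.1 hab
    have hb := b.2
    let b' : Fin k := ⟨b - 1, by omega⟩
    have hb' : J.elt b' < I.elt b := by
      rcases eq_or_ne a b' with h | h
      · rw [← h]; exact h2
      · have hlt : b' < b := by rw [Fin.lt_def]; show (b : ℕ) - 1 < b; omega
        have h5 : (a : ℕ) ≠ b - 1 := fun h' => h (Fin.ext h')
        rw [← hM b' (by rw [Fin.lt_def]; show (a : ℕ) < b - 1; omega) hlt]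
        exact I.elt_strictMono hlt
    have hIa := I.le_elt a
    rw [Fin.lt_def] at h1 h2 h3 hb'
    rcases hshape with ⟨s, hs⟩ | ⟨c, hs⟩
    · rw [hs] at hb' h3
      have : (b' : ℕ) = b - 1 := rfl
      omega
    · rw [hs] at hb' h3 h1
      have : (b' : ℕ) = b - 1 := rfl
      split_ifs at hb' h3 h1 <;> omega
  · rintro ⟨a, b, hab, hM, h1, h2, h3⟩
    have hab' := Fin.lt_def.1 hab
    have hb := b.2
    let a' : Fin k := ⟨a + 1, by omega⟩
    have ha' : I.elt a < J.elt a' := by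
      rcases eq_or_ne a' b with h | h
      · rw [h]; exact h2
      · have hlt : a < a' := by rw [Fin.lt_def]; show (a : ℕ) < a + 1; omega
        have h5 : (a : ℕ) + 1 ≠ b := fun h' => h (Fin.ext h')
        rw [hM a' hlt (by rw [Fin.lt_def]; show (a : ℕ) + 1 < b; omega)]
        exact I.elt_strictMono hlt
    have hIb := I.elt_lt b
    rw [Fin.lt_def] at h1 h2 h3 ha'
    have : (a' : ℕ) = a + 1 := rfl
    rcases hshape with ⟨s, hs⟩ | ⟨c, hs⟩
    · rw [hs] at ha' h1
      omega
    · rw [hs] at ha' h3 h1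
      split_ifs at ha' h3 h1 <;> omega

lemma mem_ofFun {f : Fin k → Fin n} {hf : ∀ ⦃r s⦄, r < s → f r < f s} {x : Fin n} :
    x ∈ (KSubset.ofFun f hf).1 ↔ ∃ r, f r = x := by
  simp [KSubset.ofFun]

/-- The interval `{a, …, a + k - 1}`. -/
def interval (hkn : k ≤ n) (a : ℕ) (ha : a ≤ n - k) : KSubset k n :=
  KSubset.ofFun (fun r => ⟨a + r, by have := r.2; omega⟩) (by
    intro r s h
    rw [Fin.lt_def] at *; dsimp only; omega)

/-- The cyclic interval made of the first `m` and the last `k - m` elements of `[n]`. -/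
def wrapped (hkn : k ≤ n) (m : ℕ) : KSubset k n :=
  KSubset.ofFun (fun r => ⟨if (r : ℕ) < m then r else n - k + r, by
    have := r.2; split_ifs <;> omega⟩) (by
      intro r s h
      rw [Fin.lt_def] at *; dsimp only; split_ifs <;> omega)

lemma isCyclicInterval_interval (hkn : k ≤ n) (a : ℕ) (ha : a ≤ n - k) :
    IsCyclicInterval (interval hkn a ha).1 := by
  refine ⟨a, k, fun x => ?_⟩
  rw [interval, mem_ofFun]
  constructor
  · rintro ⟨r, rfl⟩
    have := r.2
    exact ⟨r, r.2, by rw [Nat.mod_eq_of_lt (show a + r < n by omega)]⟩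
  · rintro ⟨t, ht, hx⟩
    refine ⟨⟨t, ht⟩, Fin.ext ?_⟩
    rw [hx, Nat.mod_eq_of_lt (show a + t < n by omega)]

lemma isCyclicInterval_wrapped (hkn : k ≤ n) (m : ℕ) (hm : m ≤ k) :
    IsCyclicInterval (wrapped hkn m).1 := by
  refine ⟨n - k + m, k, fun x => ?_⟩
  rw [wrapped, mem_ofFun]
  constructor
  · rintro ⟨r, rfl⟩
    have := r.2
    by_cases hr : (r : ℕ) < m
    · refine ⟨k - m + r, by omega, ?_⟩
      rw [show n - k + m + (k - m + r) = r + n by omega, Nat.add_mod_right,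
        Nat.mod_eq_of_lt (by omega)]
      simp [hr]
    · refine ⟨r - m, by omega, ?_⟩
      rw [show n - k + m + (r - m) = n - k + r by omega, Nat.mod_eq_of_lt (by omega)]
      simp [hr]
  · rintro ⟨t, ht, hx⟩
    by_cases htm : t < k - m
    · rw [Nat.mod_eq_of_lt (by omega)] at hx
      refine ⟨⟨m + t, by omega⟩, Fin.ext ?_⟩
      simp [hx]; omega
    · rw [show n - k + m + t = (t - (k - m)) + n by omega, Nat.add_mod_right,
        Nat.mod_eq_of_lt (by omega)] at hx
      refine ⟨⟨t - (k - m), by omega⟩, Fin.ext ?_⟩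
      simp only [hx]
      rw [if_pos (by omega)]

lemma tTilde_interval (hkn : k ≤ n) (a : ℕ) (ha : a ≤ n - k) (r : Fin k) (q : Fin (n - k)) :
    tTilde (interval hkn a ha) r q = if (q : ℕ) < a then 1 else 0 := by
  rw [tTilde_apply, interval, KSubset.elt_ofFun]
  simp

lemma tTilde_wrapped (hkn : k ≤ n) (m : ℕ) (r : Fin k) (q : Fin (n - k)) :
    tTilde (wrapped hkn m) r q = if (r : ℕ) < m then 0 else 1 := by
  rw [tTilde_apply, wrapped, KSubset.elt_ofFun]
  have := q.2
  by_cases hr : (r : ℕ) < m <;> simp [hr]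

/-! ### The projection -/

lemma proj_apply (x : TTilde k n) (r : Fin (k - 1)) :
    proj k n x r = quotMap (n - k) (x (rowHi r) - x (rowLo r)) := rfl

lemma quotMap_eq_zero_iff {N : ℕ} {x : Fin N → ℝ} :
    quotMap N x = 0 ↔ ∃ a : ℝ, ∀ q, x q = a := by
  rw [quotMap, Submodule.mkQ_apply, Submodule.Quotient.mk_eq_zero, Submodule.mem_span_singleton]
  constructor
  · rintro ⟨a, rfl⟩; exact ⟨a, fun q => by simp⟩
  · rintro ⟨a, h⟩; exact ⟨a, by ext q; simp [h]⟩

lemma proj_eq_zero_iff {x : TTilde k n} :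
    proj k n x = 0 ↔ ∀ r, ∃ a : ℝ, ∀ q, x (rowHi r) q - x (rowLo r) q = a := by
  rw [funext_iff]
  refine forall_congr' fun r => ?_
  rw [proj_apply, Pi.zero_apply, quotMap_eq_zero_iff]
  rfl

lemma proj_tTilde (J : KSubset k n) : proj k n (tTilde J) = tVec J := by
  funext r
  rw [proj_apply, tVec]
  congr 1
  funext q
  rw [Pi.sub_apply, tTilde_apply, tTilde_apply]
  have h1 : (J.elt (rowLo r) : ℕ) < J.elt (rowHi r) :=
    J.elt_strictMono (by rw [Fin.lt_def]; simp [rowLo, rowHi])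
  have h2 : ((rowLo r : Fin k) : ℕ) = r := rfl
  have h3 : ((rowHi r : Fin k) : ℕ) = r + 1 := rfl
  have key : (J.j (rowLo r) - (((r : ℕ) : ℤ) + 1 - 1) ≤ ((q : ℕ) : ℤ) + 1 ∧
      ((q : ℕ) : ℤ) + 1 ≤ J.j (rowHi r) - (((r : ℕ) : ℤ) + 1 + 1)) ↔
      (¬ (q : ℕ) + r < J.elt (rowLo r) ∧ (q : ℕ) + (r + 1) < J.elt (rowHi r)) := by
    unfold KSubset.j; omega
  rw [h2, h3]
  refine Eq.trans ?_ (if_congr key rfl rfl).symm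
  split_ifs <;> first | omega | simp

lemma tVec_of_isCyclicInterval (hkn : k < n) {J : KSubset k n} (hJ : IsCyclicInterval J.1) :
    tVec J = 0 := by
  rw [← proj_tTilde, proj_eq_zero_iff]
  intro r
  simp only [tTilde_apply]
  have h2 : ((rowLo r : Fin k) : ℕ) = r := rfl
  have h3 : ((rowHi r : Fin k) : ℕ) = r + 1 := rfl
  rcases elt_of_isCyclicInterval hkn hJ with ⟨a, h⟩ | ⟨c, h⟩
  · refine ⟨0, fun q => ?_⟩
    rw [h, h]
    simp
  · refine ⟨(if (r : ℕ) + 1 < c then 0 else 1) - (if (r : ℕ) < c then 0 else 1), fun q => ?_⟩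
    have := q.2
    rw [h, h, h2, h3]
    split_ifs <;> first | omega | simp

/-- The kernel of the projection is spanned by the cyclic intervals. -/
lemma mem_span_lifted_of_proj_eq_zero (hk : 2 ≤ k) (hkn : k < n) {x : TTilde k n}
    (hx : proj k n x = 0) (t : ℝ) :
    (t, x) ∈ Submodule.span ℝ (lifted '' {J : KSubset k n | IsCyclicInterval J.1}) := by
  set S := Submodule.span ℝ (lifted '' {J : KSubset k n | IsCyclicInterval J.1}) with hS
  have hmem : ∀ J : KSubset k n, IsCyclicInterval J.1 → lifted J ∈ S := fun J hJ =>
    Submodule.subset_span ⟨J, hJ, rfl⟩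
  let r₀ : Fin k := ⟨0, by omega⟩
  let q₀ : Fin (n - k) := ⟨0, by omega⟩
  rw [proj_eq_zero_iff] at hx
  -- in the kernel, the difference of any two rows is constant
  have hrow : ∀ m (hm : m < k) q, x ⟨m, hm⟩ q - x r₀ q = x ⟨m, hm⟩ q₀ - x r₀ q₀ := by
    intro m
    induction m with
    | zero => intro hm q; simp [r₀]
    | succ m ih =>
      intro hm q
      obtain ⟨a, ha⟩ := hx ⟨m, by omega⟩
      have h1 := ha q
      have h2 := ha q₀
      have h3 := ih (by omega) q
      simp only [rowHi, rowLo] at h1 h2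
      linarith
  have hsplit : (t, x) = t • lifted (interval hkn.le 0 (Nat.zero_le _)) +
      (∑ q : Fin (n - k), x r₀ q • (lifted (interval hkn.le (q + 1) q.2) -
        lifted (interval hkn.le q q.2.le)) +
      ∑ r : Fin k, (x r q₀ - x r₀ q₀) • (lifted (wrapped hkn.le r) -
        lifted (wrapped hkn.le (r + 1)))) := by
    refine Prod.ext ?_ ?_
    · simp [lifted, Prod.fst_sum]
    · funext r q
      simp only [lifted, Prod.snd_add, Prod.snd_sum, Prod.smul_snd, Prod.snd_sub, Pi.add_apply,
        Finset.sum_apply, Pi.smul_apply, Pi.sub_apply, tTilde_interval, tTilde_wrapped, smul_eq_mul]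
      have e1 : ∀ q' : Fin (n - k), ((if (q : ℕ) < q' + 1 then (1 : ℝ) else 0) -
          if (q : ℕ) < q' then 1 else 0) = if q = q' then 1 else 0 := by
        intro q'
        simp only [Fin.ext_iff]
        split_ifs <;> first | omega | simp
      have e2 : ∀ r' : Fin k, ((if (r : ℕ) < r' then (0 : ℝ) else 1) -
          if (r : ℕ) < r' + 1 then 0 else 1) = if r = r' then 1 else 0 := by
        intro r'
        simp only [Fin.ext_iff]
        split_ifs <;> first | omega | simp
      simp only [e1, e2, mul_ite, mul_one, mul_zero, sum_ite_eq, mem_univ, if_true]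
      have := hrow r r.2 q
      simp only [Fin.eta] at this
      simp
      linarith
  rw [hsplit]
  refine S.add_mem (S.smul_mem _ (hmem _ (isCyclicInterval_interval _ _ _)))
    (S.add_mem (S.sum_mem fun q _ => S.smul_mem _ (S.sub_mem ?_ ?_))
      (S.sum_mem fun r _ => S.smul_mem _ (S.sub_mem ?_ ?_)))
  · exact hmem _ (isCyclicInterval_interval _ _ _)
  · exact hmem _ (isCyclicInterval_interval _ _ _)
  · exact hmem _ (isCyclicInterval_wrapped _ _ r.2.le)
  · exact hmem _ (isCyclicInterval_wrapped _ _ r.2)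

/-! ### Integer points are sums of vertices -/

/-- A staircase-shaped indicator function is a vertex of the order polytope. -/
lemma exists_tTilde_eq (hkn : k ≤ n) (χ : Fin k → Fin (n - k) → Prop) [∀ r q, Decidable (χ r q)]
    (hq : ∀ r q q', q ≤ q' → χ r q' → χ r q) (hr : ∀ r r' q, r ≤ r' → χ r q → χ r' q) :
    ∃ J : KSubset k n, ∀ r q, tTilde J r q = if χ r q then 1 else 0 := by
  set l : Fin k → ℕ := fun r => (univ.filter fun q => χ r q).card with hl
  have hln : ∀ r, l r ≤ n - k := fun r => (card_le_univ _).trans (by simp)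
  have hmono : ∀ r r', r ≤ r' → l r ≤ l r' := fun r r' h => card_le_card fun q hq' => by
    rw [mem_filter] at *; exact ⟨mem_univ _, hr r r' q h hq'.2⟩
  refine ⟨KSubset.ofFun (fun r => ⟨r + l r, by have := r.2; have := hln r; omega⟩)
    (by
      intro r s h
      have := hmono r s h.le
      rw [Fin.lt_def] at *; dsimp only; omega), fun r q => ?_⟩
  · rw [tTilde_apply, KSubset.elt_ofFun]
    refine if_congr ?_ rfl rfl
    dsimp only
    rw [add_comm, Nat.add_lt_add_iff_left]
    constructor
    · intro h
      by_contra hχ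
      have : (univ.filter fun q => χ r q) ⊆ Iio q := fun q' hq' => by
        rw [mem_filter] at hq'
        rw [mem_Iio]
        by_contra hle
        exact hχ (hq r q q' (not_lt.1 hle) hq'.2)
      have := card_le_card this
      rw [Fin.card_Iio] at this
      exact absurd h (not_lt.2 this)
    · intro h
      have : Iic q ⊆ (univ.filter fun q => χ r q) := fun q' hq' => by
        rw [mem_Iic] at hq'
        rw [mem_filter]
        exact ⟨mem_univ _, hq r q' q hq' h⟩
      have := card_le_card this
      rw [Fin.card_Iic] at this
      exact this

/-- An integer array that is monotone in both directions is the sum of its level sets. -/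
lemma mem_closure_of_monotone (hkn : k ≤ n) (x : Fin k → Fin (n - k) → ℤ) (t : ℕ)
    (hq : ∀ r q q', q ≤ q' → x r q' ≤ x r q) (hr : ∀ r r' q, r ≤ r' → x r q ≤ x r' q)
    (h0 : ∀ r q, 0 ≤ x r q) (ht : ∀ r q, x r q ≤ t) :
    (fun r q => (x r q : ℝ)) ∈ AddSubmonoid.closure (Set.range (tTilde (k := k) (n := n))) := by
  have : ∀ u : ℕ, ∃ J : KSubset k n, ∀ r q, tTilde J r q = if (u : ℤ) < x r q then 1 else 0 :=
    fun u => exists_tTilde_eq hkn (fun r q => (u : ℤ) < x r q)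
      (fun r q q' h h' => h'.trans_le (hq r q q' h)) (fun r r' q h h' => h'.trans_le (hr r r' q h))
  choose L hL using this
  have hsum : (fun r q => (x r q : ℝ)) = ∑ u ∈ range t, tTilde (L u) := by
    funext r q
    rw [Finset.sum_apply, Finset.sum_apply]
    simp only [hL]
    obtain ⟨m, hm⟩ := Int.eq_ofNat_of_zero_le (h0 r q)
    have hmt : m ≤ t := by have := ht r q; omega
    rw [hm, ← sum_filter]
    have : (range t).filter (fun u : ℕ => (u : ℤ) < (m : ℤ)) = range m := by
      ext u; simp only [mem_filter, mem_range]; omega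
    rw [this]
    simp
  rw [hsum]
  exact AddSubmonoid.sum_mem _ fun u _ => AddSubmonoid.subset_closure ⟨L u, rfl⟩

/-- Every integer point is a sum of vertices up to a sum of vertices killed by the projection. -/
lemma exists_add_mem_closure (hkn : k ≤ n) (z : Fin k → Fin (n - k) → ℤ) :
    ∃ y ∈ AddSubmonoid.closure (Set.range (tTilde (k := k) (n := n))), proj k n y = 0 ∧
      (fun r q => (z r q : ℝ)) + y ∈ AddSubmonoid.closure (Set.range (tTilde (k := k) (n := n))) := by
  obtain ⟨B, hB⟩ : ∃ B : ℕ, ∀ r q, |z r q| ≤ B := by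
    refine ⟨∑ r, ∑ q, (z r q).natAbs, fun r q => ?_⟩
    rw [Int.abs_eq_natAbs]
    have h1 := single_le_sum (f := fun q => (z r q).natAbs) (fun _ _ => Nat.zero_le _) (mem_univ q)
    have h2 := single_le_sum (f := fun r => ∑ q, (z r q).natAbs) (fun _ _ => Nat.zero_le _)
      (mem_univ r)
    exact_mod_cast h1.trans h2
  -- a strictly monotone array of large slope whose rows differ by constants
  set y : Fin k → Fin (n - k) → ℤ := fun r q => (2 * B : ℤ) * (r + (n - k - q : ℕ)) with hy
  have hyq : ∀ r q q', q ≤ q' → y r q' ≤ y r q := by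
    intro r q q' h
    rw [Fin.le_def] at h
    refine mul_le_mul_of_nonneg_left ?_ (by positivity)
    have := q.2; have := q'.2
    omega
  have hyr : ∀ r r' q, r ≤ r' → y r q ≤ y r' q := by
    intro r r' q h
    rw [Fin.le_def] at h
    refine mul_le_mul_of_nonneg_left ?_ (by positivity)
    omega
  have hy0 : ∀ r q, 0 ≤ y r q := fun r q => by simp only [hy]; positivity
  have hyt : ∀ r q, y r q ≤ (2 * B * (k + n) : ℕ) := by
    intro r q
    simp only [hy]
    push_cast
    refine mul_le_mul_of_nonneg_left ?_ (by positivity)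
    have := r.2
    omega
  have hz1 : ∀ r q, -(B : ℤ) ≤ z r q := fun r q => (abs_le.1 (hB r q)).1
  have hz2 : ∀ r q, z r q ≤ B := fun r q => (abs_le.1 (hB r q)).2
  refine ⟨fun r q => (y r q : ℝ), mem_closure_of_monotone hkn y _ hyq hyr hy0 hyt, ?_, ?_⟩
  · rw [proj_eq_zero_iff]
    refine fun r => ⟨2 * B, fun q => ?_⟩
    simp only [hy, rowHi, rowLo]
    push_cast
    ring
  · have : (fun r q => (z r q : ℝ)) + (fun r q => (y r q : ℝ)) =
        fun r q => ((z r q + y r q : ℤ) : ℝ) := by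
      funext r q; simp
    rw [this]
    refine mem_closure_of_monotone hkn _ (B + 2 * B * (k + n)) ?_ ?_ ?_ ?_
    · intro r q q' h
      rcases eq_or_lt_of_le h with rfl | h
      · exact le_rfl
      · have : y r q' + 2 * B ≤ y r q := by
          simp only [hy]
          rw [Fin.lt_def] at h
          have h2 := q.2; have h3 := q'.2
          have : ((n - k - q' : ℕ) : ℤ) + 1 ≤ ((n - k - q : ℕ) : ℤ) := by omega
          nlinarith
        linarith [hz1 r q, hz2 r q']
    · intro r r' q h
      rcases eq_or_lt_of_le h with rfl | h
      · exact le_rfl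
      · have : y r q + 2 * B ≤ y r' q := by
          simp only [hy]
          rw [Fin.lt_def] at h
          have : ((r : ℕ) : ℤ) + 1 ≤ ((r' : ℕ) : ℤ) := by omega
          nlinarith
        linarith [hz1 r' q, hz2 r q]
    · intro r q
      have : 2 * (B : ℤ) ≤ y r q := by
        simp only [hy]
        have := q.2
        have : (1 : ℤ) ≤ ((r : ℕ) : ℤ) + ((n - k - q : ℕ) : ℤ) := by omega
        nlinarith
      linarith [hz1 r q, (Nat.cast_nonneg B : (0 : ℤ) ≤ B)]
    · intro r q
      have := hyt r q
      push_cast at this ⊢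
      linarith [hz2 r q]

/-! ### Cones and polytopes spanned by finite families -/

lemma single_one_nonneg {E : Type*} [DecidableEq E] (J L : E) :
    (0 : ℝ) ≤ (Pi.single J 1 : E → ℝ) L := by
  rw [Pi.single_apply]; positivity

lemma support_single_one_subset {E : Type*} [DecidableEq E] {K : Set E} {J : E} (hJ : J ∈ K) :
    Function.support (Pi.single J 1 : E → ℝ) ⊆ K := by
  intro L hL
  by_contra h
  exact hL (Pi.single_eq_of_ne (by rintro rfl; exact h hJ) _)

section Hulls

variable {E V : Type*} [Fintype E] [AddCommGroup V] [Module ℝ V] (v : E → V)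

lemma mem_hull_image_iff {K : Set E} {x : V} :
    x ∈ PointedCone.hull ℝ (v '' K) ↔
      ∃ c : E → ℝ, (∀ J, 0 ≤ c J) ∧ Function.support c ⊆ K ∧ ∑ J, c J • v J = x := by
  classical
  constructor
  · intro hx
    induction hx using Submodule.span_induction with
    | mem x hx =>
      obtain ⟨J, hJ, rfl⟩ := hx
      refine ⟨Pi.single J 1, single_one_nonneg J, support_single_one_subset hJ, ?_⟩
      simp [Pi.single_apply, ite_smul]
    | zero => exact ⟨0, fun _ => le_rfl, by simp, by simp⟩
    | add x y _ _ hx hy =>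
      obtain ⟨c, c1, c2, rfl⟩ := hx
      obtain ⟨d, d1, d2, rfl⟩ := hy
      exact ⟨c + d, fun J => add_nonneg (c1 J) (d1 J),
        (Function.support_add c d).trans (Set.union_subset c2 d2),
        by simp [add_smul, sum_add_distrib]⟩
    | smul a x _ hx =>
      obtain ⟨c, c1, c2, rfl⟩ := hx
      refine ⟨fun J => (a : ℝ) * c J, fun J => mul_nonneg a.2 (c1 J),
        fun J hJ => c2 fun h => hJ (by simp [h]), ?_⟩
      rw [← Nonneg.coe_smul, smul_sum]
      exact sum_congr rfl fun J _ => mul_smul _ _ _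
  · rintro ⟨c, c1, c2, rfl⟩
    refine Submodule.sum_mem _ fun J _ => ?_
    by_cases hJ : c J = 0
    · simp [hJ]
    · exact PointedCone.smul_mem _ (c1 J) (PointedCone.subset_hull ⟨J, c2 hJ, rfl⟩)

lemma mem_convexHull_image_iff {K : Set E} {x : V} :
    x ∈ convexHull ℝ (v '' K) ↔ ∃ c : E → ℝ, (∀ J, 0 ≤ c J) ∧ Function.support c ⊆ K ∧
      ∑ J, c J = 1 ∧ ∑ J, c J • v J = x := by
  classical
  constructor
  · intro hx
    refine convexHull_min (t := {x | ∃ c : E → ℝ, (∀ J, 0 ≤ c J) ∧ Function.support c ⊆ K ∧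
      ∑ J, c J = 1 ∧ ∑ J, c J • v J = x}) ?_ ?_ hx
    · rintro _ ⟨J, hJ, rfl⟩
      refine ⟨Pi.single J 1, single_one_nonneg J, support_single_one_subset hJ, ?_, ?_⟩
      · simp
      · simp [Pi.single_apply, ite_smul]
    · rintro _ ⟨c, c1, c2, c3, rfl⟩ _ ⟨d, d1, d2, d3, rfl⟩ a b ha hb hab
      refine ⟨a • c + b • d, fun J => ?_, fun J hJ => ?_, ?_, ?_⟩
      · exact add_nonneg (mul_nonneg ha (c1 J)) (mul_nonneg hb (d1 J))
      · by_contra hK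
        refine hJ ?_
        have e1 : c J = 0 := by by_contra h; exact hK (c2 h)
        have e2 : d J = 0 := by by_contra h; exact hK (d2 h)
        simp [e1, e2]
      · simp [sum_add_distrib, ← mul_sum, c3, d3, hab]
      · simp [sum_add_distrib, add_smul, mul_smul, smul_sum]
  · rintro ⟨c, c1, c2, c3, rfl⟩
    have e1 : ∑ J with c J ≠ 0, c J = 1 := by rw [sum_filter_ne_zero, c3]
    have e2 : ∑ J with c J ≠ 0, c J • v J = ∑ J, c J • v J :=
      sum_filter_of_ne fun J _ h h0 => h (by rw [h0, zero_smul])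
    rw [← e2]
    exact (convex_convexHull ℝ _).sum_mem (fun J _ => c1 J) e1 fun J hJ =>
      subset_convexHull ℝ _ ⟨J, c2 (mem_filter.1 hJ).2, rfl⟩

end Hulls

/-! ### Simplicial fans from unique decompositions -/

section Fan

variable {E V : Type*} [Fintype E] [AddCommGroup V] [Module ℝ V] {v : E → V} {𝒦 : Set (Set E)}

lemma UniqueDecomposition.isFaceOf_hull (hu : UniqueDecomposition v 𝒦) (hlow : IsLowerSet 𝒦)
    {K L : Set E} (hK : K ∈ 𝒦) (hLK : L ⊆ K) :
    (PointedCone.hull ℝ (v '' L)).IsFaceOf (PointedCone.hull ℝ (v '' K)) := by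
  refine ⟨Submodule.span_mono (Set.image_mono hLK), ?_⟩
  intro x y a hx hy ha hxy
  rw [mem_hull_image_iff] at *
  obtain ⟨c, c1, c2, rfl⟩ := hx
  obtain ⟨d, d1, d2, rfl⟩ := hy
  obtain ⟨e, e1, e2, he⟩ := hxy
  refine ⟨c, c1, fun J hJ => e2 fun h0 => ?_, rfl⟩
  have hpos : 0 < c J := lt_of_le_of_ne (c1 J) (Ne.symm hJ)
  have := hu e (fun J => a * c J + d J) e1
    (fun J => add_nonneg (mul_nonneg ha.le (c1 J)) (d1 J))
    (hlow (e2.trans hLK) hK) (hlow (fun J hJ => ?_) hK) (by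
      rw [he]; simp [add_smul, mul_smul, sum_add_distrib, smul_sum])
  · have h1 := congrFun this J
    rw [h0] at h1
    have := mul_pos ha hpos
    linarith [d1 J]
  · by_contra hJK
    have e1 : c J = 0 := by by_contra h; exact hJK (c2 h)
    have e2 : d J = 0 := by by_contra h; exact hJK (d2 h)
    exact hJ (by simp [e1, e2])

lemma UniqueDecomposition.hull_inf_hull (hu : UniqueDecomposition v 𝒦) (hlow : IsLowerSet 𝒦)
    {K L : Set E} (hK : K ∈ 𝒦) (hL : L ∈ 𝒦) :
    PointedCone.hull ℝ (v '' K) ⊓ PointedCone.hull ℝ (v '' L) =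
      PointedCone.hull ℝ (v '' (K ∩ L)) := by
  refine le_antisymm ?_ (le_inf (Submodule.span_mono (Set.image_mono Set.inter_subset_left))
    (Submodule.span_mono (Set.image_mono Set.inter_subset_right)))
  rintro x ⟨hxK, hxL⟩
  obtain ⟨c, c1, c2, rfl⟩ := (mem_hull_image_iff v).1 hxK
  obtain ⟨d, d1, d2, hd⟩ := (mem_hull_image_iff v).1 hxL
  have := hu c d c1 d1 (hlow c2 hK) (hlow d2 hL) hd.symm
  exact (mem_hull_image_iff v).2 ⟨c, c1, Set.subset_inter c2 (this ▸ d2), rfl⟩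

lemma UniqueDecomposition.subset_of_hull_le (hu : UniqueDecomposition v 𝒦) (hlow : IsLowerSet 𝒦)
    {K L : Set E} (hK : K ∈ 𝒦) (hL : L ∈ 𝒦)
    (h : PointedCone.hull ℝ (v '' K) ≤ PointedCone.hull ℝ (v '' L)) : K ⊆ L := by
  classical
  intro J hJ
  obtain ⟨d, d1, d2, hd⟩ := (mem_hull_image_iff v).1 (h (PointedCone.subset_hull ⟨J, hJ, rfl⟩))
  have := hu (Pi.single J 1) d (single_one_nonneg J) d1
    (hlow (support_single_one_subset hJ) hK) (hlow d2 hL)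
    (by rw [hd]; simp [Pi.single_apply, ite_smul])
  exact d2 (by rw [← this]; simp)

lemma UniqueDecomposition.injOn_hull (hu : UniqueDecomposition v 𝒦) (hlow : IsLowerSet 𝒦) :
    Set.InjOn (fun K => PointedCone.hull ℝ (v '' K)) 𝒦 := fun _ hK _ hL h =>
  (hu.subset_of_hull_le hlow hK hL h.le).antisymm (hu.subset_of_hull_le hlow hL hK h.ge)

/-- If nonnegative combinations with supports in a simplicial complex are unique, then the cones
over its members form a fan. -/
lemma UniqueDecomposition.isFan (hu : UniqueDecomposition v 𝒦) (hlow : IsLowerSet 𝒦)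
    (h0 : ∅ ∈ 𝒦) : IsFan ((fun K => PointedCone.hull ℝ (v '' K)) '' 𝒦) where
  finite := (Set.toFinite 𝒦).image _
  nonempty := ⟨_, ∅, h0, rfl⟩
  polyhedral := by
    rintro _ ⟨K, -, rfl⟩
    exact ⟨v '' K, Set.toFinite _, rfl⟩
  stronglyConvex := by
    rintro _ ⟨K, hK, rfl⟩ x hx hx'
    obtain ⟨c, c1, c2, rfl⟩ := (mem_hull_image_iff v).1 hx
    obtain ⟨d, d1, d2, hd⟩ := (mem_hull_image_iff v).1 hx'
    have := hu.eq_zero hlow hK (g := c + d)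
      ((Function.support_add c d).trans (Set.union_subset c2 d2))
      (by simp [add_smul, sum_add_distrib, hd])
    refine sum_eq_zero fun J _ => ?_
    have h1 := congrFun this J
    simp only [Pi.add_apply, Pi.zero_apply] at h1
    rw [show c J = 0 by linarith [c1 J, d1 J], zero_smul]
  face_mem := by
    rintro _ ⟨K, hK, rfl⟩ D hD
    refine ⟨{J ∈ K | v J ∈ D}, hlow (fun J hJ => hJ.1) hK, le_antisymm ?_ ?_⟩
    · refine Submodule.span_le.2 ?_
      rintro _ ⟨J, hJ, rfl⟩
      exact hJ.2
    · intro x hx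
      obtain ⟨c, c1, c2, rfl⟩ := (mem_hull_image_iff v).1 (hD.le hx)
      refine (mem_hull_image_iff v).2 ⟨c, c1, fun J hJ => ⟨c2 hJ, ?_⟩, rfl⟩
      have hmem : ∀ L, c L • v L ∈ PointedCone.hull ℝ (v '' K) := by
        intro L
        by_cases hL : c L = 0
        · simp [hL]
        · exact PointedCone.smul_mem _ (c1 L) (PointedCone.subset_hull ⟨L, c2 hL, rfl⟩)
      have h1 := hD.mem_of_sum_mem hmem hx J
      have := PointedCone.smul_mem D (inv_nonneg.2 (c1 J)) h1
      rwa [inv_smul_smul₀ hJ] at this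
  inter_isFaceOf := by
    rintro _ ⟨K, hK, rfl⟩ _ ⟨L, hL, rfl⟩
    dsimp only
    rw [hu.hull_inf_hull hlow hK hL]
    exact ⟨hu.isFaceOf_hull hlow hK Set.inter_subset_left,
      hu.isFaceOf_hull hlow hL Set.inter_subset_right⟩

end Fan

lemma isLatticeBasis_of_linearIndepOn {V : Type} [AddCommGroup V] [Module ℝ V] {L : AddSubgroup V}
    {S : Set V} (hli : LinearIndepOn ℝ id S) (hSL : S ⊆ L)
    (hspan : ∀ x ∈ L, x ∈ Submodule.span ℤ S) : IsLatticeBasis L S := by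
  have h1 : LinearIndependent ℤ (fun s : S => (s : V)) :=
    LinearIndependent.restrict_scalars (R := ℤ) (K := ℝ) (fun a b h => by simpa using h) hli
  have h2 : LinearIndependent ℤ (fun s : S => (⟨s, hSL s.2⟩ : L)) :=
    LinearIndependent.of_comp L.subtype.toIntLinearMap h1
  have h3 : ⊤ ≤ Submodule.span ℤ (Set.range fun s : S => (⟨s, hSL s.2⟩ : L)) := by
    rintro ⟨x, hx⟩ -
    have h4 : S = L.subtype.toIntLinearMap '' (Set.range fun s : S => (⟨s, hSL s.2⟩ : L)) := by
      ext y
      constructor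
      · exact fun hy => ⟨⟨y, hSL hy⟩, ⟨⟨y, hy⟩, rfl⟩, rfl⟩
      · rintro ⟨_, ⟨s, rfl⟩, rfl⟩; exact s.2
    have h5 := hspan x hx
    rw [h4, ← Submodule.map_span] at h5
    obtain ⟨y, hy, hyx⟩ := h5
    have : y = ⟨x, hx⟩ := Subtype.ext hyx
    rwa [← this]
  refine ⟨S, Module.Basis.mk h2 h3, ?_⟩
  ext y
  simp

/-! ### The noncrossing complexes -/

/-- The vertices of the order polytope, placed at height one, with the noncrossing relation. -/
lemma exchangeSystem (k n : ℕ) :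
    ExchangeSystem (lifted (k := k) (n := n)) Noncrossing height (LinearMap.fst ℝ ℝ _) where
  refl := noncrossing_self
  deg_eq _ := rfl
  exchange I J h := by
    obtain ⟨I', J', h1, h2⟩ := exists_exchange h
    exact ⟨I', J', Prod.ext rfl h1, h2⟩
  unique c d hc hd hcs hds h := noncrossing_unique hc hd (fun I J hI hJ => hcs I hI J hJ)
    (fun I J hI hJ => hds I hI J hJ) h

lemma isLowerSet_noncrossingComplex : IsLowerSet (noncrossingComplex k n) :=
  fun _ _ hLK hK => ⟨fun I hI => hK.1 I (hLK hI), fun I hI J hJ => hK.2 I (hLK hI) J (hLK hJ)⟩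

lemma empty_mem_noncrossingComplex : ∅ ∈ noncrossingComplex k n :=
  ⟨fun _ h => absurd h (Set.notMem_empty _), fun _ h => absurd h (Set.notMem_empty _)⟩

lemma noncrossingComplex_subset : noncrossingComplex k n ⊆ fullNoncrossingComplex k n :=
  fun _ hK => hK.2

lemma noncyclicPart_mem {K : Set (KSubset k n)} (hK : K ∈ fullNoncrossingComplex k n) :
    noncyclicPart K ∈ noncrossingComplex k n :=
  ⟨fun _ hI => hI.2, fun I hI J hJ => hK I hI.1 J hJ.1⟩

/-- The set of all cyclic intervals of size `k`. -/
def cyclicIntervals (k n : ℕ) : Set (KSubset k n) := {J | IsCyclicInterval J.1}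

lemma union_cyclicIntervals_mem (hkn : k < n) {K : Set (KSubset k n)}
    (hK : K ∈ fullNoncrossingComplex k n) :
    K ∪ cyclicIntervals k n ∈ fullNoncrossingComplex k n := by
  rintro I (hI | hI) J (hJ | hJ)
  · exact hK I hI J hJ
  · exact noncrossing_of_isCyclicInterval hkn hJ I
  · exact (noncrossing_of_isCyclicInterval hkn hI J).symm
  · exact noncrossing_of_isCyclicInterval hkn hJ I

lemma cyclicIntervals_subset_of_maximal (hkn : k < n) {K : Set (KSubset k n)}
    (hK : Maximal (· ∈ fullNoncrossingComplex k n) K) : cyclicIntervals k n ⊆ K :=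
  Set.subset_union_right.trans
    (hK.le_of_ge (union_cyclicIntervals_mem hkn hK.prop) Set.subset_union_left)

lemma noncyclicPart_union_of_maximal (hkn : k < n) {K : Set (KSubset k n)}
    (hK : Maximal (· ∈ fullNoncrossingComplex k n) K) :
    noncyclicPart K ∪ cyclicIntervals k n = K := by
  refine Set.Subset.antisymm
    (Set.union_subset (fun J hJ => hJ.1) (cyclicIntervals_subset_of_maximal hkn hK)) ?_
  intro J hJ
  by_cases h : IsCyclicInterval J.1
  · exact Or.inr h
  · exact Or.inl ⟨hJ, h⟩

lemma noncyclicPart_union (L : Set (KSubset k n)) (hL : L ∈ noncrossingComplex k n) :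
    noncyclicPart (L ∪ cyclicIntervals k n) = L := by
  ext J
  constructor
  · rintro ⟨h | h, h'⟩
    · exact h
    · exact absurd h h'
  · exact fun h => ⟨Or.inl h, hL.1 J h⟩

lemma bijOn_noncyclicPart (hkn : k < n) : Set.BijOn noncyclicPart
    {K : Set (KSubset k n) | Maximal (· ∈ fullNoncrossingComplex k n) K}
    {K | Maximal (· ∈ noncrossingComplex k n) K} := by
  refine ⟨fun K hK => ⟨noncyclicPart_mem hK.prop, fun L hL hKL J hJ => ⟨?_, hL.1 J hJ⟩⟩,
    fun K hK L hL h => ?_, fun L hL => ⟨L ∪ cyclicIntervals k n, ⟨?_, ?_⟩, ?_⟩⟩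
  · refine hK.le_of_ge (union_cyclicIntervals_mem hkn (noncrossingComplex_subset hL)) ?_ (Or.inl hJ)
    rw [← noncyclicPart_union_of_maximal hkn hK]
    exact Set.union_subset_union_left _ hKL
  · rw [← noncyclicPart_union_of_maximal hkn hK, ← noncyclicPart_union_of_maximal hkn hL, h]
  · exact union_cyclicIntervals_mem hkn (noncrossingComplex_subset hL.prop)
  · intro K hK hLK J hJ
    by_cases h : IsCyclicInterval J.1
    · exact Or.inr h
    · refine Or.inl (hL.le_of_ge (noncyclicPart_mem hK) (fun I hI => ?_) ⟨hJ, h⟩)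
      exact ⟨hLK (Or.inl hI), hL.prop.1 I hI⟩
  · exact noncyclicPart_union L hL.prop

/-- Decompositions of a point of the quotient space are unique: two of them differ by an element
of the kernel of the projection, that is, by cyclic intervals, and these can be added to any
noncrossing collection. -/
lemma uniqueDecomposition_tVec (hk : 2 ≤ k) (hkn : k < n) :
    UniqueDecomposition (tVec (k := k) (n := n)) (noncrossingComplex k n) := by
  classical
  intro c d hc hd hcs hds h
  have h0 : proj k n (∑ J, c J • tTilde J - ∑ J, d J • tTilde J) = 0 := by
    simp only [map_sub, map_sum, map_smul, proj_tTilde, h, sub_self]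
  have hmem := mem_span_lifted_of_proj_eq_zero hk hkn h0 (∑ J, c J - ∑ J, d J)
  rw [Finsupp.mem_span_image_iff_linearCombination] at hmem
  obtain ⟨a, ha, hsum⟩ := hmem
  rw [Finsupp.linearCombination_apply,
    Finsupp.sum_fintype a (fun i b => b • lifted i) (fun _ => zero_smul _ _)] at hsum
  have ha' : ∀ J, ¬ IsCyclicInterval J.1 → a J = 0 := by
    intro J hJ
    by_contra h'
    exact hJ ((Finsupp.mem_supported _ _).1 ha (by simpa using h'))
  have hsum' : ∑ J, a J • lifted J = ∑ J, c J • lifted J - ∑ J, d J • lifted J := by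
    rw [hsum, sum_smul_lifted, sum_smul_lifted]; rfl
  have hsupp : ∀ e : KSubset k n → ℝ, Function.support e ∈ noncrossingComplex k n →
      ∀ b : KSubset k n → ℝ, (∀ J, ¬ IsCyclicInterval J.1 → b J = 0) →
      Function.support (e + b) ∈ fullNoncrossingComplex k n := by
    intro e he b hb
    refine isLowerSet_cliques Noncrossing ((Function.support_add e b).trans
      (Set.union_subset_union_right _ fun J hJ => ?_))
      (union_cyclicIntervals_mem hkn (noncrossingComplex_subset he))
    by_contra h'
    exact hJ (hb J h')
  have key := (exchangeSystem k n).unique (c + fun J => max (-a J) 0) (d + fun J => max (a J) 0)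
    (fun J => add_nonneg (hc J) (le_max_right _ _)) (fun J => add_nonneg (hd J) (le_max_right _ _))
    (hsupp c hcs _ fun J hJ => by simp [ha' J hJ]) (hsupp d hds _ fun J hJ => by simp [ha' J hJ])
    (by
      simp only [Pi.add_apply, add_smul, sum_add_distrib]
      rw [← sub_eq_zero, add_sub_add_comm, ← hsum', ← sum_sub_distrib, ← sum_add_distrib]
      refine sum_eq_zero fun J _ => ?_
      rw [← sub_smul, ← add_smul]
      have : a J + (max (-a J) 0 - max (a J) 0) = 0 := by
        have := max_zero_sub_max_neg_zero_eq_self (a J)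
        linarith
      rw [this, zero_smul])
  funext J
  by_cases hJ : IsCyclicInterval J.1
  · have h1 : c J = 0 := by by_contra h'; exact hcs.1 J h' hJ
    have h2 : d J = 0 := by by_contra h'; exact hds.1 J h' hJ
    rw [h1, h2]
  · have := congrFun key J
    simpa [ha' J hJ] using this

/-! ### Lattices -/

lemma tTilde_mem_lattice (J : KSubset k n) : tTilde J ∈ latticeTTilde k n := by
  refine ⟨fun r q => if (q : ℕ) + r < J.elt r then 1 else 0, ?_⟩
  funext r q
  rw [tTilde_apply]
  push_cast
  rfl

lemma closure_le_span : AddSubmonoid.closure (Set.range (tTilde (k := k) (n := n))) ≤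
    (Submodule.span ℤ (Set.range (tTilde (k := k) (n := n)))).toAddSubmonoid :=
  AddSubmonoid.closure_le.2 Submodule.subset_span

lemma lattice_subset_span (hkn : k ≤ n) {x : TTilde k n} (hx : x ∈ latticeTTilde k n) :
    x ∈ Submodule.span ℤ (Set.range (tTilde (k := k) (n := n))) := by
  obtain ⟨z, rfl⟩ := hx
  obtain ⟨y, hy, -, hzy⟩ := exists_add_mem_closure hkn z
  have h1 := closure_le_span hy
  have h2 := closure_le_span hzy
  exact (Submodule.add_mem_iff_left _ h1).1 h2

lemma tVec_mem_lattice (J : KSubset k n) : tVec J ∈ latticeT k n := by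
  obtain ⟨z, hz⟩ := tTilde_mem_lattice J
  refine ⟨fun r q => z (rowHi r) q - z (rowLo r) q, ?_⟩
  rw [← proj_tTilde, hz]
  funext r
  rw [proj_apply]
  congr 1
  funext q
  simp

/-- The differences of consecutive rows of an array can be prescribed. -/
lemma exists_row_differences {A : Type*} [AddCommGroup A] (z : Fin (k - 1) → Fin (n - k) → A) :
    ∃ x : Fin k → Fin (n - k) → A, ∀ r q, x (rowHi r) q - x (rowLo r) q = z r q := by
  refine ⟨fun r q => ∑ i : Fin (k - 1), if (i : ℕ) < r then z i q else 0, fun r q => ?_⟩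
  rw [← sum_sub_distrib]
  have : ∀ i : Fin (k - 1), ((if (i : ℕ) < (rowHi r : Fin k) then z i q else 0) -
      if (i : ℕ) < (rowLo r : Fin k) then z i q else 0) = if i = r then z i q else 0 := by
    intro i
    have h2 : ((rowLo r : Fin k) : ℕ) = r := rfl
    have h3 : ((rowHi r : Fin k) : ℕ) = r + 1 := rfl
    rw [h2, h3]
    simp only [Fin.ext_iff]
    split_ifs <;> first | omega | simp
  simp [this]

/-- The projection maps the integer points onto the integer points. -/
lemma exists_proj_eq {y : TSpace k n} (hy : y ∈ latticeT k n) :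
    ∃ x ∈ latticeTTilde k n, proj k n x = y := by
  obtain ⟨z, rfl⟩ := hy
  obtain ⟨x, hx⟩ := exists_row_differences z
  refine ⟨fun r q => (x r q : ℝ), ⟨_, rfl⟩, ?_⟩
  funext r
  rw [proj_apply]
  congr 1
  funext q
  rw [Pi.sub_apply, ← Int.cast_sub, hx]

lemma proj_surjective : Function.Surjective (proj k n) := by
  intro y
  choose w hw using fun r => Submodule.mkQ_surjective _ (y r)
  obtain ⟨x, hx⟩ := exists_row_differences w
  refine ⟨x, ?_⟩
  funext r
  rw [proj_apply, ← hw r]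
  congr 1
  funext q
  exact hx r q

/-- The generators of a maximal cone form a lattice basis. -/
lemma isLatticeBasis_tVec (hk : 2 ≤ k) (hkn : k < n) {K : Set (KSubset k n)}
    (hK : Maximal (· ∈ fullNoncrossingComplex k n) K) :
    IsLatticeBasis (latticeT k n) (tVec '' noncyclicPart K) := by
  refine isLatticeBasis_of_linearIndepOn ?_ ?_ ?_
  · exact ((uniqueDecomposition_tVec hk hkn).linearIndepOn isLowerSet_noncrossingComplex
      (noncyclicPart_mem hK.prop)).id_image
  · rintro _ ⟨J, -, rfl⟩
    exact tVec_mem_lattice J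
  · intro y hy
    obtain ⟨x, hx, rfl⟩ := exists_proj_eq hy
    have hall : ∀ P : KSubset k n, tVec P ∈ Submodule.span ℤ (tVec '' noncyclicPart K) := by
      intro P
      have h1 := (exchangeSystem k n).mem_span_int hK P
      let ψ : (ℝ × TTilde k n) →ₗ[ℤ] TSpace k n :=
        ((proj k n).comp (LinearMap.snd ℝ ℝ (TTilde k n))).restrictScalars ℤ
      have hψ : ∀ J, ψ (lifted J) = tVec J := fun J => proj_tTilde J
      rw [← hψ P]
      refine (Submodule.span_le (p := (Submodule.span ℤ (tVec '' noncyclicPart K)).comap ψ)).2 ?_ h1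
      rintro _ ⟨J, hJ, rfl⟩
      show ψ (lifted J) ∈ Submodule.span ℤ (tVec '' noncyclicPart K)
      rw [hψ]
      by_cases hJc : IsCyclicInterval J.1
      · rw [tVec_of_isCyclicInterval hkn hJc]; exact Submodule.zero_mem _
      · exact Submodule.subset_span ⟨J, ⟨hJ, hJc⟩, rfl⟩
    refine (Submodule.span_le (p := (Submodule.span ℤ (tVec '' noncyclicPart K)).comap
      ((proj k n).restrictScalars ℤ))).2 ?_ (lattice_subset_span hkn.le hx)
    rintro _ ⟨J, rfl⟩
    show proj k n (tTilde J) ∈ Submodule.span ℤ (tVec '' noncyclicPart K)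
    rw [proj_tTilde]
    exact hall J

lemma isPartOfLatticeBasis_tVec (hk : 2 ≤ k) (hkn : k < n) {K : Set (KSubset k n)}
    (hK : K ∈ noncrossingComplex k n) : IsPartOfLatticeBasis (latticeT k n) (tVec '' K) := by
  obtain ⟨L, hKL, hL⟩ := exists_maximal_clique (noncrossingComplex_subset hK)
  obtain ⟨ι, b, hb⟩ := isLatticeBasis_tVec hk hkn hL
  exact ⟨ι, b, hb ▸ Set.image_mono fun J hJ => ⟨hKL hJ, hK.1 J hJ⟩⟩

/-! ### Completeness of the fan -/

/-- Every vector is a nonnegative combination of the generators. -/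
lemma mem_hull_range_tVec (hkn : k < n) (y : TSpace k n) :
    y ∈ PointedCone.hull ℝ (tVec '' (Set.univ : Set (KSubset k n))) := by
  classical
  set C := PointedCone.hull ℝ (tVec '' (Set.univ : Set (KSubset k n))) with hC
  have hint : ∀ z : Fin k → Fin (n - k) → ℤ, proj k n (fun r q => (z r q : ℝ)) ∈ C := by
    intro z
    obtain ⟨x, -, hx0, hx⟩ := exists_add_mem_closure hkn.le z
    have h1 : proj k n (fun r q => (z r q : ℝ)) = proj k n ((fun r q => (z r q : ℝ)) + x) := by
      rw [map_add, hx0, add_zero]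
    rw [h1]
    generalize (fun r q => (z r q : ℝ)) + x = w at hx
    induction hx using AddSubmonoid.closure_induction with
    | mem w hw =>
      obtain ⟨J, rfl⟩ := hw
      rw [proj_tTilde]
      exact PointedCone.subset_hull ⟨J, Set.mem_univ _, rfl⟩
    | zero => rw [map_zero]; exact C.zero_mem
    | add v w _ _ hv hw => rw [map_add]; exact C.add_mem hv hw
  obtain ⟨x, rfl⟩ := proj_surjective y
  have hx : x = ∑ r, ∑ q, |x r q| • (fun r' q' =>
      ((if r' = r ∧ q' = q then (SignType.sign (x r q) : ℤ) else 0 : ℤ) : ℝ)) := by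
    funext r q
    simp only [Finset.sum_apply, Pi.smul_apply, smul_eq_mul]
    rw [sum_eq_single r, sum_eq_single q]
    · simp only [and_self, if_true]
      rw [mul_comm]
      have := sign_mul_abs (x r q)
      rcases lt_trichotomy (x r q) 0 with h | h | h
      · simp [sign_neg h, abs_of_neg h]
      · simp [h]
      · simp [sign_pos h, abs_of_pos h]
    · intro q' _ hq'; simp [hq'.symm]
    · simp
    · intro r' _ hr'; simp [hr'.symm]
    · simp
  rw [hx, map_sum]
  refine C.sum_mem fun r _ => ?_
  rw [map_sum]
  refine C.sum_mem fun q _ => ?_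
  rw [map_smul]
  exact PointedCone.smul_mem C (abs_nonneg _) (hint _)

lemma isComplete_noncrossingFan (hkn : k < n) : IsComplete (noncrossingFan k n) := by
  intro y
  obtain ⟨c, c1, -, rfl⟩ := (mem_hull_image_iff tVec).1 (mem_hull_range_tVec hkn y)
  obtain ⟨d, d1, d2, d3, -⟩ :=
    (exchangeSystem k n).exists_compatible isCoefficientSet_nonneg (c := c) c1
  refine ⟨cone (noncyclicPart (Function.support d)), ⟨_, noncyclicPart_mem d3, rfl⟩, ?_⟩
  have h1 : ∑ J, c J • tVec J = ∑ J, d J • tVec J := by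
    rw [sum_smul_lifted, sum_smul_lifted, Prod.mk.injEq] at d2
    have := congrArg (proj k n) d2.2
    simp only [map_sum, map_smul, proj_tTilde] at this
    exact this.symm
  rw [h1]
  refine Submodule.sum_mem _ fun J _ => ?_
  by_cases hJ : IsCyclicInterval J.1
  · rw [tVec_of_isCyclicInterval hkn hJ, smul_zero]; exact Submodule.zero_mem _
  by_cases hd : d J = 0
  · rw [hd, zero_smul]; exact Submodule.zero_mem _
  · exact PointedCone.smul_mem _ (d1 J) (PointedCone.subset_hull ⟨J, ⟨hd, hJ⟩, rfl⟩)

/-! ### The triangulation of the order polytope -/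

lemma tTilde_unique {K L : Set (KSubset k n)} (hK : K ∈ fullNoncrossingComplex k n)
    (hL : L ∈ fullNoncrossingComplex k n) {c d : KSubset k n → ℝ} (hc : ∀ J, 0 ≤ c J)
    (hd : ∀ J, 0 ≤ d J) (hcK : Function.support c ⊆ K) (hdL : Function.support d ⊆ L)
    (hc1 : ∑ J, c J = 1) (hd1 : ∑ J, d J = 1)
    (h : ∑ J, c J • tTilde J = ∑ J, d J • tTilde J) : c = d :=
  (exchangeSystem k n).unique c d hc hd (isLowerSet_cliques Noncrossing hcK hK)
    (isLowerSet_cliques Noncrossing hdL hL)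
    (by rw [sum_smul_lifted, sum_smul_lifted, hc1, hd1, h])

lemma affineIndependent_of_image {K : Set (KSubset k n)} (hK : K ∈ fullNoncrossingComplex k n)
    {σ : Finset (TTilde k n)} (hσ : (σ : Set (TTilde k n)) = tTilde '' K) :
    AffineIndependent ℝ ((↑) : σ → TTilde k n) := by
  classical
  have hmem : ∀ x : σ, ∃ J ∈ K, tTilde J = x := fun x => by
    have : (x : TTilde k n) ∈ (σ : Set (TTilde k n)) := x.2
    rwa [hσ] at this
  choose g hgK hg using hmem
  have hginj : Function.Injective g := fun x y h => Subtype.ext (by rw [← hg x, ← hg y, h])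
  have hli : LinearIndependent ℝ (fun x : σ => lifted (g x)) := by
    have h1 := (exchangeSystem k n).unique.linearIndepOn (isLowerSet_cliques _) hK
    exact LinearIndependent.comp h1 (fun x : σ => (⟨g x, hgK x⟩ : K))
      fun x y h => hginj (congrArg Subtype.val h)
  rw [affineIndependent_iff]
  intro s w hw0 hw
  refine linearIndependent_iff'.1 hli s w ?_
  refine Prod.ext ?_ ?_
  · simpa [Prod.fst_sum, lifted] using hw0
  · simpa [Prod.snd_sum, lifted, hg] using hw

/-- The simplices spanned by the noncrossing collections form a simplicial complex. -/
def noncrossingTriangulation (k n : ℕ) : Geometry.SimplicialComplex ℝ (TTilde k n) where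
  faces := {σ : Finset (TTilde k n) | σ.Nonempty ∧ ∃ K ∈ fullNoncrossingComplex k n,
    (σ : Set (TTilde k n)) = tTilde '' K}
  isRelLowerSet_faces := by
    rintro σ ⟨hσ, K, hK, hσK⟩
    refine ⟨hσ, fun τ hτσ hτ => ⟨hτ, {J ∈ K | tTilde J ∈ τ},
      isLowerSet_cliques Noncrossing (fun J hJ => hJ.1) hK, ?_⟩⟩
    ext x
    constructor
    · intro hx
      have : x ∈ (σ : Set (TTilde k n)) := hτσ hx
      rw [hσK] at this
      obtain ⟨J, hJ, rfl⟩ := this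
      exact ⟨J, ⟨hJ, hx⟩, rfl⟩
    · rintro ⟨J, hJ, rfl⟩
      exact hJ.2
  indep := by
    rintro σ ⟨-, K, hK, hσK⟩
    exact affineIndependent_of_image hK hσK
  inter_subset_convexHull := by
    rintro σ τ ⟨-, K, hK, hσ⟩ ⟨-, L, hL, hτ⟩ x ⟨hx1, hx2⟩
    rw [hσ] at hx1 ⊢
    rw [hτ] at hx2 ⊢
    obtain ⟨c, c1, c2, c3, rfl⟩ := (mem_convexHull_image_iff _).1 hx1
    obtain ⟨d, d1, d2, d3, hd⟩ := (mem_convexHull_image_iff _).1 hx2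
    have hcd := tTilde_unique hK hL c1 d1 c2 d2 c3 d3 hd.symm
    rw [← Set.image_inter tTilde_injective]
    exact (mem_convexHull_image_iff _).2 ⟨c, c1, Set.subset_inter c2 (hcd ▸ d2), c3, rfl⟩

lemma exists_finset_eq_image (K : Set (KSubset k n)) :
    ∃ σ : Finset (TTilde k n), (σ : Set (TTilde k n)) = tTilde '' K :=
  ⟨(Set.toFinite (tTilde '' K)).toFinset, Set.Finite.coe_toFinset _⟩

lemma isTriangulationOf_orderPolytope :
    IsTriangulationOf (noncrossingTriangulation k n) (orderPolytope k n) := by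
  classical
  constructor
  · refine (univ.image (tTilde (k := k) (n := n))).powerset.finite_toSet.subset ?_
    rintro σ ⟨-, K, -, hσ⟩
    rw [mem_coe, mem_powerset, ← coe_subset, hσ, coe_image]
    exact Set.image_mono (by simp)
  · refine Set.Subset.antisymm ?_ ?_
    · intro x hx
      obtain ⟨σ, ⟨-, K, -, hσ⟩, hx⟩ := Geometry.SimplicialComplex.mem_space_iff.1 hx
      rw [hσ] at hx
      exact convexHull_mono (Set.image_subset_range _ _) hx
    · intro x hx
      rw [orderPolytope, ← Set.image_univ] at hx
      obtain ⟨c, c1, -, c3, rfl⟩ := (mem_convexHull_image_iff _).1 hx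
      obtain ⟨d, d1, d2, d3, -⟩ :=
        (exchangeSystem k n).exists_compatible isCoefficientSet_nonneg (c := c) c1
      rw [sum_smul_lifted, sum_smul_lifted, Prod.mk.injEq, c3] at d2
      obtain ⟨σ, hσ⟩ := exists_finset_eq_image (Function.support d)
      refine Geometry.SimplicialComplex.mem_space_iff.2 ⟨σ, ⟨?_, _, d3, hσ⟩, ?_⟩
      · rw [← coe_nonempty, hσ, Set.image_nonempty, Function.support_nonempty_iff]
        rintro rfl
        simp at d2
      · rw [hσ]
        exact (mem_convexHull_image_iff _).2 ⟨d, d1, subset_rfl, d2⟩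

lemma exists_maximal_of_mem_facets {σ : Finset (TTilde k n)}
    (hσ : σ ∈ (noncrossingTriangulation k n).facets) :
    ∃ K, Maximal (· ∈ fullNoncrossingComplex k n) K ∧ (σ : Set (TTilde k n)) = tTilde '' K := by
  obtain ⟨⟨hne, K, hK, hσK⟩, hmax⟩ := Geometry.SimplicialComplex.mem_facets.1 hσ
  refine ⟨K, ⟨hK, fun L hL hKL => ?_⟩, hσK⟩
  obtain ⟨τ, hτ⟩ := exists_finset_eq_image L
  have hστ : σ ⊆ τ := by
    rw [← coe_subset, hσK, hτ]; exact Set.image_mono hKL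
  have := hmax τ ⟨hne.mono hστ, L, hL, hτ⟩ hστ
  rw [← this, hσK] at hτ
  exact (tTilde_injective.image_injective hτ).ge

lemma isUnimodularTriangulation_noncrossing (hkn : k < n) :
    IsUnimodularTriangulation (latticeTTilde k n) (noncrossingTriangulation k n) := by
  classical
  intro σ hσ v hv
  obtain ⟨K, hK, hσK⟩ := exists_maximal_of_mem_facets hσ
  have hv' : v ∈ (σ : Set (TTilde k n)) := hv
  rw [hσK] at hv'
  obtain ⟨J₀, hJ₀, rfl⟩ := hv'
  have hS : {x | ∃ w ∈ σ, w ≠ tTilde J₀ ∧ x = w - tTilde J₀} =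
      (fun J => tTilde J - tTilde J₀) '' (K \ {J₀}) := by
    ext x
    constructor
    · rintro ⟨w, hw, hne, rfl⟩
      have hw' : w ∈ (σ : Set (TTilde k n)) := hw
      rw [hσK] at hw'
      obtain ⟨J, hJ, rfl⟩ := hw'
      exact ⟨J, ⟨hJ, fun h => hne (by rw [Set.mem_singleton_iff.1 h])⟩, rfl⟩
    · rintro ⟨J, ⟨hJ, hne⟩, rfl⟩
      refine ⟨tTilde J, ?_, fun h => hne (tTilde_injective h), rfl⟩
      rw [← mem_coe, hσK]; exact ⟨J, hJ, rfl⟩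
  rw [hS]
  refine isLatticeBasis_of_linearIndepOn ?_ ?_ ?_
  · refine (linearIndepOn_of_forall_eq_zero fun g hg h0 => ?_).id_image
    have h1 := (exchangeSystem k n).unique.eq_zero (isLowerSet_cliques _) hK.prop
      (g := g - Pi.single J₀ (∑ J, g J)) (fun J hJ => ?_) (by
        simp only [Pi.sub_apply, sub_smul, sum_sub_distrib, sum_smul_lifted, Pi.single_apply,
          ite_smul, zero_smul, sum_ite_eq', mem_univ, if_true]
        refine Prod.ext (by simp [lifted]) ?_
        simp only [lifted, Prod.snd_sub, Prod.smul_snd, Prod.snd_zero]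
        rw [← h0]
        simp only [smul_sub, sum_sub_distrib, ← sum_smul])
    · funext J
      by_cases hJ : J = J₀
      · subst hJ
        by_contra h
        exact (hg h).2 rfl
      · have := congrFun h1 J
        simpa [Pi.single_apply, hJ] using this
    · by_contra hJK
      have hne : J ≠ J₀ := fun h => hJK (h ▸ hJ₀)
      have : g J = 0 := by by_contra h; exact hJK (hg h).1
      exact hJ (by simp [this, hne])
  · rintro _ ⟨J, -, rfl⟩
    exact sub_mem (tTilde_mem_lattice J) (tTilde_mem_lattice J₀)
  · intro x hx
    set S := Submodule.span ℤ ((fun J => tTilde J - tTilde J₀) '' (K \ {J₀})) with hSdef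
    let ψ : (ℝ × TTilde k n) →ₗ[ℤ] TTilde k n := (LinearMap.snd ℝ ℝ (TTilde k n) -
      (LinearMap.fst ℝ ℝ (TTilde k n)).smulRight (tTilde J₀)).restrictScalars ℤ
    have hψ : ∀ J, ψ (lifted J) = tTilde J - tTilde J₀ := by
      intro J
      show tTilde J - (1 : ℝ) • tTilde J₀ = _
      rw [one_smul]
    have hall : ∀ P : KSubset k n, tTilde P - tTilde J₀ ∈ S := by
      intro P
      rw [← hψ P]
      refine (Submodule.span_le (p := S.comap ψ)).2 ?_ ((exchangeSystem k n).mem_span_int hK P)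
      rintro _ ⟨J, hJ, rfl⟩
      show ψ (lifted J) ∈ S
      rw [hψ]
      by_cases h : J = J₀
      · rw [h, sub_self]; exact S.zero_mem
      · exact Submodule.subset_span ⟨J, ⟨hJ, h⟩, rfl⟩
    -- the origin is a vertex of the order polytope
    have h0 : tTilde (wrapped hkn.le k) = 0 := by
      funext r q
      rw [tTilde_wrapped, if_pos r.2]; rfl
    refine Submodule.span_le.2 ?_ (lattice_subset_span hkn.le hx)
    rintro _ ⟨P, rfl⟩
    have := S.sub_mem (hall P) (hall (wrapped hkn.le k))
    rwa [h0, zero_sub, sub_neg_eq_add, sub_add_cancel] at this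

lemma isRegularTriangulation_noncrossing :
    IsRegularTriangulation (Set.range tTilde) (noncrossingTriangulation k n) := by
  have hω : ∀ J : KSubset k n, Function.extend tTilde height 0 (tTilde J) = height J := fun J =>
    tTilde_injective.extend_apply _ _ _
  refine ⟨Function.extend tTilde height 0, fun σ hσ => ⟨?_, ?_⟩⟩
  · rintro ⟨-, K, hK, hσK⟩
    obtain ⟨f, hf1, hf2⟩ := (exchangeSystem k n).exists_supporting hK
    refine ⟨(f.comp (LinearMap.inr ℝ ℝ (TTilde k n))).toAffineMap +
      AffineMap.const ℝ (TTilde k n) (f (1, 0)), ?_, ?_⟩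
    all_goals
      have hl : ∀ J : KSubset k n, ((f.comp (LinearMap.inr ℝ ℝ (TTilde k n))).toAffineMap +
          AffineMap.const ℝ (TTilde k n) (f (1, 0))) (tTilde J) = f (lifted J) := by
        intro J
        show f (0, tTilde J) + f (1, 0) = f (lifted J)
        rw [← map_add]
        simp [lifted]
    · rintro _ ⟨J, rfl⟩
      rw [hl, hω]
      exact hf1 J
    · rw [hσK]
      ext x
      constructor
      · rintro ⟨J, hJ, rfl⟩
        exact ⟨⟨J, rfl⟩, by rw [hl, hω]; exact (hf2 J).2 hJ⟩
      · rintro ⟨⟨J, rfl⟩, hx⟩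
        rw [hl, hω] at hx
        exact ⟨J, (hf2 J).1 hx, rfl⟩
  · rintro ⟨l, hl1, hl2⟩
    let f : (ℝ × TTilde k n) →ₗ[ℝ] ℝ :=
      LinearMap.coprod (LinearMap.toSpanSingleton ℝ ℝ (l 0)) l.linear
    have hf : ∀ J : KSubset k n, f (lifted J) = l (tTilde J) := by
      intro J
      have : l (tTilde J) = l.linear (tTilde J) + l 0 := congrFun (AffineMap.decomp l) (tTilde J)
      simp [f, lifted, this, add_comm]
    refine ⟨hσ, {J | f (lifted J) = height J},
      (exchangeSystem k n).mem_cliques_of_supporting f fun J => ?_, ?_⟩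
    · rw [hf, ← hω]
      exact hl1 _ ⟨J, rfl⟩
    · rw [hl2]
      ext x
      constructor
      · rintro ⟨⟨J, rfl⟩, hx⟩
        rw [hω] at hx
        exact ⟨J, (hf J).trans hx, rfl⟩
      · rintro ⟨J, hJ, rfl⟩
        exact ⟨⟨J, rfl⟩, by rw [hω, ← hf]; exact hJ⟩

/-! ### The projected simplices -/

lemma hull_convexHull {V : Type*} [AddCommGroup V] [Module ℝ V] (S : Set V) :
    PointedCone.hull ℝ (convexHull ℝ S) = PointedCone.hull ℝ S :=
  le_antisymm
    (Submodule.span_le.2 (convexHull_min PointedCone.subset_hull (PointedCone.convex _)))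
    (Submodule.span_mono (subset_convexHull ℝ S))

lemma image_proj_simplex (K : Set (KSubset k n)) :
    proj k n '' simplex K = convexHull ℝ (tVec '' K) := by
  rw [simplex, LinearMap.image_convexHull, Set.image_image]
  simp only [proj_tTilde]

lemma hull_image_tVec (hkn : k < n) (K : Set (KSubset k n)) :
    PointedCone.hull ℝ (tVec '' K) = cone (noncyclicPart K) := by
  refine le_antisymm (Submodule.span_le.2 ?_)
    (Submodule.span_mono (Set.image_mono fun J hJ => hJ.1))
  rintro _ ⟨J, hJ, rfl⟩
  by_cases h : IsCyclicInterval J.1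
  · rw [tVec_of_isCyclicInterval hkn h]; exact Submodule.zero_mem _
  · exact PointedCone.subset_hull ⟨J, ⟨hJ, h⟩, rfl⟩

lemma image_tVec_of_maximal (hkn : k < n) {K : Set (KSubset k n)}
    (hK : Maximal (· ∈ fullNoncrossingComplex k n) K) :
    tVec '' K = insert 0 (tVec '' noncyclicPart K) := by
  refine Set.Subset.antisymm ?_ ?_
  · rintro _ ⟨J, hJ, rfl⟩
    by_cases h : IsCyclicInterval J.1
    · exact Or.inl (tVec_of_isCyclicInterval hkn h)
    · exact Or.inr ⟨J, ⟨hJ, h⟩, rfl⟩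
  · refine Set.insert_subset ?_ (Set.image_mono fun J hJ => hJ.1)
    have h := isCyclicInterval_wrapped hkn.le k le_rfl
    exact ⟨_, cyclicIntervals_subset_of_maximal hkn hK h, tVec_of_isCyclicInterval hkn h⟩

end NCFan

theorem theorem2p3 (k n : ℕ) (hk : 2 ≤ k) (hkn : k < n) :
    -- the noncrossing fan is a complete unimodular simplicial fan
    (NCFan.IsFan (NCFan.noncrossingFan k n) ∧
      NCFan.IsComplete (NCFan.noncrossingFan k n) ∧
      NCFan.IsUnimodular (NCFan.latticeT k n) (NCFan.noncrossingFan k n) ∧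
      (∀ C ∈ NCFan.noncrossingFan k n, C.IsSimplicial)) ∧
    -- its cones are indexed by the noncrossing complex, with the given vectors as generators
    (Set.InjOn (NCFan.cone (k := k) (n := n)) (NCFan.noncrossingComplex k n) ∧
      ∀ K ∈ NCFan.noncrossingComplex k n,
        LinearIndepOn ℝ NCFan.tVec K ∧
          NCFan.IsPartOfLatticeBasis (NCFan.latticeT k n) (NCFan.tVec '' K)) ∧
    -- the noncrossing triangulation of the order polytope is regular and unimodular
    (∃ T : Geometry.SimplicialComplex ℝ (NCFan.TTilde k n),
      T.faces = {σ : Finset (NCFan.TTilde k n) | σ.Nonempty ∧ ∃ K ∈ NCFan.fullNoncrossingComplex k n,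
        (σ : Set (NCFan.TTilde k n)) = NCFan.tTilde '' K} ∧
      NCFan.IsTriangulationOf T (NCFan.orderPolytope k n) ∧
      NCFan.IsUnimodularTriangulation (NCFan.latticeTTilde k n) T ∧
      NCFan.IsRegularTriangulation (Set.range NCFan.tTilde) T) ∧
    -- the noncrossing fan is obtained by projecting this triangulation
    ((∀ J : NCFan.KSubset k n, NCFan.proj k n (NCFan.tTilde J) = NCFan.tVec J) ∧
      Set.BijOn NCFan.noncyclicPart
        {K | Maximal (· ∈ NCFan.fullNoncrossingComplex k n) K}
        {K | Maximal (· ∈ NCFan.noncrossingComplex k n) K} ∧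
      (∀ K, Maximal (· ∈ NCFan.fullNoncrossingComplex k n) K →
        NCFan.proj k n '' NCFan.simplex K =
            convexHull ℝ (insert 0 (NCFan.tVec '' NCFan.noncyclicPart K)) ∧
          PointedCone.hull ℝ (NCFan.proj k n '' NCFan.simplex K) =
            NCFan.cone (NCFan.noncyclicPart K)) ∧
      NCFan.noncrossingFan k n =
        {C | ∃ K ∈ NCFan.fullNoncrossingComplex k n,
          C = PointedCone.hull ℝ (NCFan.proj k n '' NCFan.simplex K)}) := by
  have hu := NCFan.uniqueDecomposition_tVec hk hkn
  have hlow := NCFan.isLowerSet_noncrossingComplex (k := k) (n := n)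
  refine ⟨⟨hu.isFan hlow NCFan.empty_mem_noncrossingComplex, NCFan.isComplete_noncrossingFan hkn,
    ?_, ?_⟩, ⟨hu.injOn_hull hlow, fun K hK => ⟨hu.linearIndepOn hlow hK,
      NCFan.isPartOfLatticeBasis_tVec hk hkn hK⟩⟩,
    ⟨NCFan.noncrossingTriangulation k n, rfl, NCFan.isTriangulationOf_orderPolytope,
      NCFan.isUnimodularTriangulation_noncrossing hkn, NCFan.isRegularTriangulation_noncrossing⟩,
    NCFan.proj_tTilde, NCFan.bijOn_noncyclicPart hkn, fun K hK => ⟨?_, ?_⟩, ?_⟩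
  · rintro _ ⟨K, hK, rfl⟩
    exact ⟨_, NCFan.isPartOfLatticeBasis_tVec hk hkn hK, rfl⟩
  · rintro _ ⟨K, hK, rfl⟩
    exact PointedCone.IsSimplicial.hull (Set.toFinite _) (hu.linearIndepOn hlow hK).id_image
  · rw [NCFan.image_proj_simplex, NCFan.image_tVec_of_maximal hkn hK]
  · rw [NCFan.image_proj_simplex, NCFan.hull_convexHull, NCFan.hull_image_tVec hkn]
  · ext C
    simp only [NCFan.image_proj_simplex, NCFan.hull_convexHull, NCFan.hull_image_tVec hkn]
    constructor
    · rintro ⟨K, hK, rfl⟩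
      refine ⟨K, NCFan.noncrossingComplex_subset hK, ?_⟩
      rw [show NCFan.noncyclicPart K = K from
        Set.Subset.antisymm (fun J hJ => hJ.1) fun J hJ => ⟨hJ, hK.1 J hJ⟩]
    · rintro ⟨K, hK, rfl⟩
      exact ⟨_, NCFan.noncyclicPart_mem hK, rfl⟩
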